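/- Let $\Omega\subset\mathbb C^n$ be a bounded domain (a bounded, connected, nonempty open set). Integrals are taken with respect to Lebesgue measure. For $p\ge 1$ let $A^p(\Omega)$ be the space of holomorphic functions $f$ on $\Omega$ with $\|f\|_p=\left(\int_\Omega|f|^p\right)^{1/p}<\infty$, and for $z\in\Omega$ put $$K_p(z)=\max\{|f(z)|^p:\ f\in A^p(\Omega),\ \|f\|_p=1\}.$$ Let $m_p(\cdot,z)$ be the unique element of minimal norm $\|f\|_p$ among all $f\in A^p(\Omega)$ with $f(z)=1$, and put $K_p(\zeta,z)=m_p(\zeta,z)K_p(z)$ for $\zeta,z\in\Omega$. Let $x_1,\dots,x_{2n}$ be the real coordinates of $\mathbb C^n=\mathbb R^{2n}$, with $z_k=x_k+ix_{n+k}$, and let $|\cdot|$ be the Euclidean norm. Assume that $\lim_{p\to1+}K_p(z)=K_1(z)$ for every $z\in\Omega$. Then $K_1(\cdot)\in C^{1,1/2}_{\rm loc}(\Omega)$, i.e. $K_1$ is $C^1$ on $\Omega$ and its first order partial derivatives are Hölder continuous with exponent $1/2$ on every compact subset of $\Omega$. Moreover: (1) For all $z\in\Omega$ and $1\le j\le 2n$,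 $$\frac{\partial K_1}{\partial x_j}(z)=\mathrm{Re}\,\frac{\partial K_1(\zeta,z)}{\partial \xi_j}\bigg|_{\zeta=z},$$ where $\xi_1,\dots,\xi_{2n}$ are the real coordinates of $\zeta$. (2) For every compact $S\subset\Omega$ there is a constant $C>0$ such that for all $z,z'\in S$ and $1\le j\le 2n$, $$\left|\frac{\partial K_1}{\partial x_j}(z)-\frac{\partial K_1}{\partial x_j}(z')\right|\le C|z-z'|^{1/2}\left(\|K_1(\cdot,z)-K_1(\cdot,z')\|_1^{1/2}+|z-z'|^{1/2}\right).$$ (3) For every compact $S\subset\Omega$ and $1\le j\le 2n$, $$\left|\frac{\partial K_1}{\partial x_j}(z)-\frac{\partial K_1}{\partial x_j}(z')\right|=o(|z-z'|^{1/2})$$ uniformly for $z,z'\in S$ as $|z-z'|\to0$. -/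

import Mathlib

open Filter Topology MeasureTheory
open scoped NNReal

noncomputable section

/-- Complex Euclidean space `ℂⁿ` with its Euclidean (Hermitian) norm; as a real inner product
space it is `ℝ²ⁿ`, and `volume` on it is Lebesgue measure. -/
abbrev Cn (n : ℕ) : Type := EuclideanSpace ℂ (Fin n)

/-- The norm `‖f‖_p = (∫_Ω |f|^p)^{1/p}`. -/
def bergmanNorm {n : ℕ} (Ω : Set (Cn n)) (p : ℝ) (f : Cn n → ℂ) : ℝ :=
  (∫ ζ in Ω, ‖f ζ‖ ^ p) ^ (1 / p)

/-- The `p`-Bergman space `A^p(Ω)`: holomorphic functions on `Ω` with `∫_Ω |f|^p < ∞`.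
Functions on `Ω` are represented by functions on `ℂⁿ` which vanish outside `Ω`, so that each
element of `A^p(Ω)` has exactly one representative. -/
def bergmanSpace {n : ℕ} (Ω : Set (Cn n)) (p : ℝ) : Set (Cn n → ℂ) :=
  {f | DifferentiableOn ℂ f Ω ∧ (∀ ζ, ζ ∉ Ω → f ζ = 0) ∧
    IntegrableOn (fun ζ => ‖f ζ‖ ^ p) Ω}

/-- The diagonal `p`-Bergman kernel `K_p(z) = max {|f(z)|^p : f ∈ A^p(Ω), ‖f‖_p = 1}`. -/
def bergmanKernelDiag {n : ℕ} (Ω : Set (Cn n)) (p : ℝ) (z : Cn n) : ℝ :=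
  sSup {t : ℝ | ∃ f ∈ bergmanSpace Ω p, bergmanNorm Ω p f = 1 ∧ t = ‖f z‖ ^ p}

/-- `f` minimizes `‖f‖_p` among the functions `f ∈ A^p(Ω)` with `f(z) = 1`. -/
def IsBergmanMinimizer {n : ℕ} (Ω : Set (Cn n)) (p : ℝ) (z : Cn n) (f : Cn n → ℂ) : Prop :=
  f ∈ bergmanSpace Ω p ∧ f z = 1 ∧
    ∀ g ∈ bergmanSpace Ω p, g z = 1 → bergmanNorm Ω p f ≤ bergmanNorm Ω p g

/-- The minimizer `m_p(·, z)`; it exists and is unique for `1 ≤ p < ∞`, `Ω` a bounded domain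
and `z ∈ Ω`. -/
def bergmanMinimizer {n : ℕ} (Ω : Set (Cn n)) (p : ℝ) (z : Cn n) : Cn n → ℂ :=
  Classical.epsilon (IsBergmanMinimizer Ω p z)

/-- The off-diagonal `p`-Bergman kernel `K_p(ζ, z) = m_p(ζ, z) K_p(z)`. -/
def bergmanKernel {n : ℕ} (Ω : Set (Cn n)) (p : ℝ) (ζ z : Cn n) : ℂ :=
  bergmanMinimizer Ω p z ζ * (bergmanKernelDiag Ω p z : ℂ)

/-- The standard real basis of `ℂⁿ = ℝ²ⁿ`: the vectors `e_k` (`Sum.inl k`, coordinate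
`x_k = Re z_k`) and `i e_k` (`Sum.inr k`, coordinate `x_{n+k} = Im z_k`). -/
def realBasisVec {n : ℕ} : Fin n ⊕ Fin n → Cn n
  | Sum.inl k => EuclideanSpace.single k (1 : ℂ)
  | Sum.inr k => EuclideanSpace.single k Complex.I

/-- The real partial derivative `∂u/∂x_j` at `z`. -/
def realPartial {n : ℕ} {F : Type*} [NormedAddCommGroup F] [NormedSpace ℝ F]
    (j : Fin n ⊕ Fin n) (u : Cn n → F) (z : Cn n) : F :=
  lineDeriv ℝ u z (realBasisVec j)

/-- `u ∈ C^{1,α}_loc(Ω)` for open `Ω`: `u` is `C¹` on `Ω` in the real sense and its first order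
partial derivatives are Hölder continuous with exponent `α` on compact subsets of `Ω`. -/
def IsLocC1Holder {n : ℕ} {F : Type*} [NormedAddCommGroup F] [NormedSpace ℝ F]
    (Ω : Set (Cn n)) (α : ℝ≥0) (u : Cn n → F) : Prop :=
  ContDiffOn ℝ 1 u Ω ∧
    ∀ j : Fin n ⊕ Fin n, ∀ S : Set (Cn n), S ⊆ Ω → IsCompact S →
      ∃ C : ℝ≥0, HolderOnWith C α (realPartial j u) S

end

/-!
The extremal function `k_z = K_1(·, z)` has `L¹`-norm one, `k_z(z) = K_1(z)`, and
`|f(w)| ≤ K_1(w) ‖f‖₁` for all `f ∈ A¹(Ω)` (`norm_le_bergmanKernelDiag_mul`). Minimizers exist by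
Montel's theorem (`exists_tendsto_of_integral_norm_le`) and are unique (`eq_of_extremal`). Hence
`K_1(w) ≥ Re k_z(w)` with equality at `w = z`; exchanging the roles of the two points and expanding
to second order, `K_1` is differentiable at `z` with derivative `Re k_z'(z)`, provided that
`z ↦ k_z'(z)` is continuous (`hasFDerivAt_bergmanKernelDiag_one`). Everything thus reduces to the
modulus of continuity of `z ↦ k_z'(z)`.

Let `f = k_z`, `g = k_{z'}` and let `D = ‖f‖₁ + ‖g‖₁ - ‖f + g‖₁ = 2 - ‖f + g‖₁` be the defect in the
triangle inequality. Evaluating `f + g` at `z` and at `z'` gives `K_1(z) D ≤ Re (f - g)(z)` and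
`K_1(z') D ≤ -Re (f - g)(z')`, so that `D ≤ C |z - z'| ‖f - g‖₁` by the Cauchy estimates for `f - g`.
On the other hand, where `g` is bounded away from zero, `(Im (f / g))²` is bounded by a multiple of
`|f| + |g| - |f + g|` (`im_div_sq_le`). Since `(Im (f / g))²` is subharmonic, `Im (f / g) = O(√D)`
near `z`, and the imaginary part of a holomorphic function controls its derivative, so
`(f / g)'(z) = O(√D)` (`exists_norm_fderiv_div_le`). Together with
`f' - g' = (f / g - 1) g' + g (f / g)'` and `|f / g - 1| = O(|z - z'|)` at `z`, this yields
`|k_z'(z) - k_{z'}'(z')| ≤ C |z - z'|^{1/2} (‖k_z - k_{z'}‖₁^{1/2} + |z - z'|^{1/2})`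
(`exists_norm_fderiv_bergmanKernel_sub_le`).

The Hölder bound follows from `‖k_z - k_{z'}‖₁ ≤ 2`. For the little-o statement, `z ↦ k_z` is
continuous into `L¹` (`tendsto_integral_norm_bergmanKernel_sub`), hence uniformly continuous on
compact sets. The case `D = 0` of the bound for `(f / g)'` also gives the uniqueness of minimizers.
-/

/-! ### Cauchy estimates -/

section CauchyEstimates

open Metric

lemma mapsTo_closedBall_of_norm_le {E : Type*} [NormedAddCommGroup E] {f : E → ℂ} {c : E}
    {R M : ℝ} (hM : ∀ w ∈ ball c R, ‖f w‖ ≤ M) :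
    Set.MapsTo f (ball c R) (closedBall (f c) (2 * M)) := by
  intro w hw
  have hc : c ∈ ball c R := mem_ball_self (dist_nonneg.trans_lt hw)
  rw [mem_closedBall, dist_eq_norm]
  linarith [norm_sub_le (f w) (f c), hM w hw, hM c hc]

variable {E : Type*} [NormedAddCommGroup E] [NormedSpace ℂ E] {f : E → ℂ} {c : E} {R M : ℝ}

lemma norm_fderiv_le_of_norm_le (hR : 0 < R) (hd : DifferentiableOn ℂ f (ball c R))
    (hM : ∀ w ∈ ball c R, ‖f w‖ ≤ M) : ‖fderiv ℂ f c‖ ≤ 2 * M / R :=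
  Complex.norm_fderiv_le_div_of_mapsTo_ball hd (mapsTo_closedBall_of_norm_le hM) hR

lemma norm_sub_le_of_norm_le (hd : DifferentiableOn ℂ f (ball c R))
    (hM : ∀ w ∈ ball c R, ‖f w‖ ≤ M) {w : E} (hw : w ∈ ball c R) :
    ‖f w - f c‖ ≤ 2 * M / R * ‖w - c‖ := by
  have := Complex.dist_le_div_mul_dist_of_mapsTo_ball hd (mapsTo_closedBall_of_norm_le hM) hw
  rwa [dist_eq_norm, dist_eq_norm] at this

/-- Second order Cauchy estimate, in the form of a Lipschitz bound for the derivative. It follows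
by applying the first order estimates to the difference `w ↦ f (w + (z - c)) - f w`, so that no
holomorphy of the derivative is needed. -/
lemma norm_fderiv_sub_fderiv_le (hR : 0 < R) (hd : DifferentiableOn ℂ f (ball c (2 * R)))
    (hM : ∀ w ∈ ball c (2 * R), ‖f w‖ ≤ M) {z : E} (hz : z ∈ ball c R) :
    ‖fderiv ℂ f z - fderiv ℂ f c‖ ≤ 4 * M / R ^ 2 * ‖z - c‖ := by
  have hzn : ‖z - c‖ < R := by simpa [dist_eq_norm] using hz
  have hsub : ∀ w ∈ ball c R, ball w R ⊆ ball c (2 * R) := fun w hw =>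
    ball_subset_ball' (by have : dist w c < R := hw; linarith)
  have hmem : ∀ w ∈ ball c R, w + (z - c) ∈ ball w R := fun w _ => by
    simpa [dist_eq_norm] using hzn
  have hnhds : ∀ w ∈ ball c (2 * R), DifferentiableAt ℂ f w := fun w hw =>
    hd.differentiableAt (isOpen_ball.mem_nhds hw)
  have hc2 : c ∈ ball c (2 * R) := mem_ball_self (by positivity)
  have hz2 : c + (z - c) ∈ ball c (2 * R) := hsub c (mem_ball_self hR) (hmem c (mem_ball_self hR))
  have hshift : ∀ w ∈ ball c R, DifferentiableAt ℂ (fun w => f (w + (z - c))) w := fun w hw =>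
    (hnhds _ (hsub w hw (hmem w hw))).comp w (by fun_prop : DifferentiableAt ℂ (· + (z - c)) w)
  have hdiff : DifferentiableOn ℂ (fun w => f (w + (z - c)) - f w) (ball c R) := fun w hw =>
    ((hshift w hw).sub (hnhds w (hsub w hw (mem_ball_self hR)))).differentiableWithinAt
  have hbound : ∀ w ∈ ball c R, ‖f (w + (z - c)) - f w‖ ≤ 2 * M / R * ‖z - c‖ := fun w hw => by
    simpa using norm_sub_le_of_norm_le (hd.mono (hsub w hw)) (fun v hv => hM v (hsub w hw hv))
      (hmem w hw)
  have key := norm_fderiv_le_of_norm_le hR hdiff hbound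
  have hfd : fderiv ℂ (fun w => f (w + (z - c)) - f w) c = fderiv ℂ f z - fderiv ℂ f c := by
    rw [fderiv_fun_sub (hshift c (mem_ball_self hR)) (hnhds c hc2), fderiv_comp_add_right]
    simp
  rw [hfd] at key
  refine key.trans (le_of_eq ?_)
  field_simp
  ring

lemma norm_sub_sub_fderiv_le (hR : 0 < R) (hd : DifferentiableOn ℂ f (ball c (2 * R)))
    (hM : ∀ w ∈ ball c (2 * R), ‖f w‖ ≤ M) {z : E} (hz : z ∈ ball c R) :
    ‖f z - f c - fderiv ℂ f c (z - c)‖ ≤ 4 * M / R ^ 2 * ‖z - c‖ ^ 2 := by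
  have hM0 : 0 ≤ M := (norm_nonneg _).trans (hM c (mem_ball_self (by positivity)))
  have hsub : closedBall c ‖z - c‖ ⊆ ball c R := closedBall_subset_ball (by
    simpa [dist_eq_norm] using hz)
  have hsub2 : ball c R ⊆ ball c (2 * R) := ball_subset_ball (by linarith)
  have := (convex_closedBall c ‖z - c‖).norm_image_sub_le_of_norm_fderiv_le' (𝕜 := ℂ) (f := f)
    (φ := fderiv ℂ f c) (C := 4 * M / R ^ 2 * ‖z - c‖) (x := c) (y := z)
    (fun w hw => hd.differentiableAt (isOpen_ball.mem_nhds (hsub2 (hsub hw))))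
    (fun w hw => (norm_fderiv_sub_fderiv_le hR hd hM (hsub hw)).trans (by
      have : ‖w - c‖ ≤ ‖z - c‖ := by simpa [dist_eq_norm] using hw
      gcongr))
    (mem_closedBall_self (norm_nonneg _)) (by simp [dist_eq_norm])
  refine this.trans (le_of_eq (by ring))

/-- A bound on the imaginary part alone controls the derivative: apply the Cauchy estimate to
`exp (i s (h - h c))` with `s = 1 / M`. -/
lemma norm_fderiv_le_of_abs_im_le {h : E → ℂ} (hR : 0 < R) (hM0 : 0 ≤ M)
    (hd : DifferentiableOn ℂ h (ball c R)) (hM : ∀ w ∈ ball c R, |(h w).im| ≤ M) :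
    ‖fderiv ℂ h c‖ ≤ 2 * Real.exp 2 * M / R := by
  have main : ∀ M' : ℝ, 0 < M' → M ≤ M' → ‖fderiv ℂ h c‖ ≤ 2 * Real.exp 2 * M' / R := by
    intro M' hM' hle
    have hcb : c ∈ ball c R := mem_ball_self hR
    set a : ℂ := Complex.I * (M' : ℂ)⁻¹ with ha
    have hdc : DifferentiableAt ℂ h c := hd.differentiableAt (isOpen_ball.mem_nhds hcb)
    have hF : DifferentiableOn ℂ (fun w => Complex.exp (a * (h w - h c))) (ball c R) :=
      ((hd.sub_const _).const_mul a).cexp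
    have hFb : ∀ w ∈ ball c R, ‖Complex.exp (a * (h w - h c))‖ ≤ Real.exp 2 := by
      intro w hw
      rw [Complex.norm_exp, Real.exp_le_exp]
      have hre : (a * (h w - h c)).re = M'⁻¹ * ((h c).im - (h w).im) := by
        rw [ha, ← Complex.ofReal_inv, mul_assoc, Complex.I_mul_re,
          Complex.im_ofReal_mul, Complex.sub_im]
        ring
      rw [hre, inv_mul_le_iff₀ hM']
      have h1 := abs_le.1 ((hM w hw).trans hle)
      have h2 := abs_le.1 ((hM c hcb).trans hle)
      linarith
    have key := norm_fderiv_le_of_norm_le hR hF hFb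
    have hder : HasFDerivAt (fun w => Complex.exp (a * (h w - h c))) (a • fderiv ℂ h c) c := by
      simpa using ((hdc.hasFDerivAt.sub_const (h c)).const_mul a).cexp
    rw [hder.fderiv, norm_smul, ha] at key
    have : ‖Complex.I * (M' : ℂ)⁻¹‖ = M'⁻¹ := by simp [abs_of_pos hM']
    rw [this, inv_mul_le_iff₀ hM'] at key
    refine key.trans (le_of_eq (by ring))
  have hlim : Tendsto (fun M' : ℝ => 2 * Real.exp 2 * M' / R) (𝓝[>] M)
      (𝓝 (2 * Real.exp 2 * M / R)) :=
    ((by fun_prop : Continuous fun M' : ℝ => 2 * Real.exp 2 * M' / R).tendsto M).mono_left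
      nhdsWithin_le_nhds
  refine ge_of_tendsto hlim ?_
  filter_upwards [self_mem_nhdsWithin] with M' hM'
  exact main M' (hM0.trans_lt hM') (le_of_lt hM')

end CauchyEstimates

/-! ### The identity principle -/

/-- The identity principle in several variables, reduced to one variable along complex lines. -/
lemma eqOn_zero_of_eventually_eq_zero {E : Type*} [NormedAddCommGroup E] [NormedSpace ℂ E]
    {Ω : Set E} (hΩ : IsOpen Ω) (hconn : IsPreconnected Ω) {f : E → ℂ}
    (hf : DifferentiableOn ℂ f Ω) {z : E} (hz : z ∈ Ω) (h0 : ∀ᶠ w in 𝓝 z, f w = 0) :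
    ∀ w ∈ Ω, f w = 0 := by
  have hsub : Ω ⊆ {x | ∀ᶠ w in 𝓝 x, f w = 0} := by
    refine hconn.subset_of_closure_inter_subset isOpen_setOfPred_eventually_nhds ⟨z, hz, h0⟩ ?_
    rintro x ⟨hx, hxΩ⟩
    obtain ⟨r, hr, hball⟩ := Metric.isOpen_iff.1 hΩ x hxΩ
    obtain ⟨y, hy, hxy⟩ := Metric.mem_closure_iff.1 hx (r / 2) (by positivity)
    have hysub : Metric.ball y (r / 2) ⊆ Ω := (Metric.ball_subset_ball' (by
      rw [dist_comm] at hxy; linarith)).trans hball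
    refine Filter.eventually_of_mem (Metric.isOpen_ball.mem_nhds (Metric.mem_ball.2 hxy)) ?_
    intro w hw
    rcases eq_or_ne w y with rfl | hne
    · exact hy.self_of_nhds
    have hpos : 0 < ‖w - y‖ := norm_pos_iff.2 (sub_ne_zero.2 hne)
    have hlt : ‖w - y‖ < r / 2 := by simpa [dist_eq_norm] using hw
    have hmaps : Set.MapsTo (fun t : ℂ => y + t • (w - y)) (Metric.ball 0 (r / 2 / ‖w - y‖))
        Ω := by
      intro t ht
      apply hysub
      rw [Metric.mem_ball, dist_eq_norm, add_sub_cancel_left, norm_smul]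
      rwa [Metric.mem_ball, dist_zero_right, lt_div_iff₀ hpos] at ht
    have hg : DifferentiableOn ℂ (fun t : ℂ => f (y + t • (w - y)))
        (Metric.ball 0 (r / 2 / ‖w - y‖)) :=
      hf.comp (by fun_prop) hmaps
    have hcont : Tendsto (fun t : ℂ => y + t • (w - y)) (𝓝 0) (𝓝 y) := by
      have : Continuous (fun t : ℂ => y + t • (w - y)) := by fun_prop
      simpa using this.tendsto 0
    have hzero := (hg.analyticOnNhd Metric.isOpen_ball).eqOn_zero_of_preconnected_of_eventuallyEq_zero
      (Metric.isPreconnected_ball) (Metric.mem_ball_self (by positivity)) (hcont.eventually hy)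
    have h1 : (1 : ℂ) ∈ Metric.ball (0 : ℂ) (r / 2 / ‖w - y‖) := by
      simp [one_lt_div hpos, hlt]
    simpa using hzero h1
  exact fun w hw => (hsub hw).self_of_nhds

/-! ### Mean values over balls of `ℂⁿ` -/

section MeanValue

open Metric

variable {n : ℕ} {x : Cn n} {r R : ℝ}

lemma setIntegral_closedBall_comp_smul (f : Cn n → ℂ) {a : ℂ} (ha : ‖a‖ = 1) :
    ∫ v in closedBall (0 : Cn n) r, f (a • v) = ∫ v in closedBall (0 : Cn n) r, f v := by
  have ha0 : a ≠ 0 := norm_ne_zero_iff.1 (by simp [ha])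
  let e : Cn n ≃ₗᵢ[ℝ] Cn n :=
    { (LinearEquiv.smulOfNeZero ℂ (Cn n) a ha0).restrictScalars ℝ with
      norm_map' := fun v => (norm_smul a v).trans (by rw [ha, one_mul]) }
  have he : ∀ v, e v = a • v := fun v => rfl
  have hpre : e ⁻¹' closedBall (0 : Cn n) r = closedBall 0 r := by
    ext v; simp
  have := e.measurePreserving.setIntegral_preimage_emb e.toMeasurableEquiv.measurableEmbedding f
    (closedBall 0 r)
  rwa [hpre] at this

/-- The mean value property over balls: average the mean value property on the circles
`θ ↦ x + exp (i θ) v` over `v`, and use that rotations preserve the measure. -/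
lemma setIntegral_closedBall_add_eq {f : Cn n → ℂ} (hrR : r < R)
    (hd : DifferentiableOn ℂ f (ball x R)) :
    ∫ v in closedBall (0 : Cn n) r, f (x + v) = volume.real (closedBall (0 : Cn n) r) * f x := by
  have hmem : ∀ v ∈ closedBall (0 : Cn n) r, ∀ t : ℂ, ‖t‖ ≤ 1 → x + t • v ∈ ball x R := by
    intro v hv t ht
    have hv' : ‖v‖ ≤ r := by simpa using hv
    simp only [mem_ball, dist_eq_norm, add_sub_cancel_left, norm_smul]
    nlinarith [norm_nonneg v, norm_nonneg t]
  have hcirc : ∀ v ∈ closedBall (0 : Cn n) r,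
      ∫ θ in (0 : ℝ)..2 * Real.pi, f (x + circleMap 0 1 θ • v) = (2 * Real.pi : ℝ) * f x := by
    intro v hv
    have hg : DifferentiableOn ℂ (fun t : ℂ => f (x + t • v)) (closedBall 0 1) :=
      hd.comp (by fun_prop) fun t ht => hmem v hv t (by simpa using ht)
    have := DiffContOnCl.circleAverage (f := fun t : ℂ => f (x + t • v)) (c := 0) (R := 1)
      (by simpa using hg.diffContOnCl_ball subset_rfl)
    rw [Real.circleAverage_def, inv_smul_eq_iff₀ (by positivity)] at this
    simpa using this
  have hcont : ContinuousOn (fun q : ℝ × Cn n => f (x + circleMap 0 1 q.1 • q.2))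
      (Set.uIcc 0 (2 * Real.pi) ×ˢ closedBall 0 r) := by
    refine hd.continuousOn.comp (by fun_prop) fun q hq => hmem _ hq.2 _ (by simp)
  have hint : Integrable (Function.uncurry fun (θ : ℝ) (v : Cn n) => f (x + circleMap 0 1 θ • v))
      ((volume.restrict (Set.uIoc 0 (2 * Real.pi))).prod (volume.restrict (closedBall 0 r))) := by
    rw [Measure.prod_restrict]
    have := hcont.integrableOn_compact (μ := (volume : Measure ℝ).prod (volume : Measure (Cn n)))
      (isCompact_uIcc.prod (isCompact_closedBall _ _))
    exact this.mono_set (Set.prod_mono Set.uIoc_subset_uIcc subset_rfl)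
  have hswap := intervalIntegral_integral_swap hint
  have hleft : ∫ θ in (0 : ℝ)..2 * Real.pi, ∫ v in closedBall (0 : Cn n) r,
      f (x + circleMap 0 1 θ • v) =
      (2 * Real.pi : ℝ) * ∫ v in closedBall (0 : Cn n) r, f (x + v) := by
    rw [intervalIntegral.integral_congr (g := fun _ => ∫ v in closedBall (0 : Cn n) r, f (x + v))
      fun θ _ => setIntegral_closedBall_comp_smul (fun v => f (x + v)) (by simp)]
    simp
  have hright : ∫ v in closedBall (0 : Cn n) r, ∫ θ in (0 : ℝ)..2 * Real.pi,
      f (x + circleMap 0 1 θ • v) =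
      (2 * Real.pi : ℝ) * (volume.real (closedBall (0 : Cn n) r) * f x) := by
    rw [setIntegral_congr_fun measurableSet_closedBall hcirc, setIntegral_const]
    simp only [Complex.real_smul]
    ring
  rw [hleft, hright] at hswap
  have hpi : ((2 * Real.pi : ℝ) : ℂ) ≠ 0 := by exact_mod_cast (by positivity : 2 * Real.pi ≠ 0)
  exact mul_left_cancel₀ hpi hswap

lemma setIntegral_closedBall_eq {f : Cn n → ℂ} (hrR : r < R)
    (hd : DifferentiableOn ℂ f (ball x R)) :
    ∫ w in closedBall x r, f w = volume.real (closedBall (0 : Cn n) r) * f x := by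
  rw [← setIntegral_closedBall_add_eq hrR hd]
  have := (measurePreserving_add_left (volume : Measure (Cn n)) x).setIntegral_preimage_emb
    (MeasurableEquiv.addLeft x).measurableEmbedding f (closedBall x r)
  rw [← this]
  simp

lemma integrableOn_closedBall {f : Cn n → ℂ} (hrR : r < R)
    (hd : DifferentiableOn ℂ f (ball x R)) : IntegrableOn f (closedBall x r) :=
  (hd.continuousOn.mono (closedBall_subset_ball hrR)).integrableOn_compact (isCompact_closedBall _ _)

lemma volume_closedBall_mul_norm_le {f : Cn n → ℂ} (hrR : r < R)
    (hd : DifferentiableOn ℂ f (ball x R)) :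
    volume.real (closedBall (0 : Cn n) r) * ‖f x‖ ≤ ∫ w in closedBall x r, ‖f w‖ := by
  have := norm_integral_le_integral_norm (μ := volume.restrict (closedBall x r)) f
  rw [setIntegral_closedBall_eq hrR hd, norm_mul, Complex.norm_real, Real.norm_of_nonneg
    measureReal_nonneg] at this
  exact this

/-- The square of the imaginary part of a holomorphic function `h` is subharmonic, because
`2 (Im h)² = |h²| - Re h²`. -/
lemma volume_closedBall_mul_im_sq_le {h : Cn n → ℂ} (hrR : r < R)
    (hd : DifferentiableOn ℂ h (ball x R)) :
    volume.real (closedBall (0 : Cn n) r) * (h x).im ^ 2 ≤ ∫ w in closedBall x r, (h w).im ^ 2 := by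
  have hid : ∀ a : ℂ, a.im ^ 2 = (‖a ^ 2‖ - (a ^ 2).re) / 2 := by
    intro a
    rw [norm_pow, Complex.sq_norm, Complex.normSq_apply, pow_two a, Complex.mul_re]
    ring
  have hd2 : DifferentiableOn ℂ (fun w => h w ^ 2) (ball x R) := hd.pow 2
  have hint := integrableOn_closedBall hrR hd2
  have h1 := volume_closedBall_mul_norm_le hrR hd2
  have h2 : ∫ w in closedBall x r, (h w ^ 2).re =
      volume.real (closedBall (0 : Cn n) r) * (h x ^ 2).re := by
    rw [← Complex.re_ofReal_mul, ← setIntegral_closedBall_eq hrR hd2]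
    exact integral_re hint
  have hre : IntegrableOn (fun w => (h w ^ 2).re) (closedBall x r) := hint.re
  simp_rw [hid]
  rw [integral_div, integral_sub hint.norm hre, h2]
  linarith

end MeanValue

/-! ### Almost equality in the triangle inequality -/

/-- The defect in the triangle inequality for `a` and `b` controls how far `a / b` is from being
positive. -/
lemma im_div_sq_le {a b : ℂ} {β H : ℝ} (hβ : 0 < β) (hb : β ≤ ‖b‖) (hH : ‖a / b‖ ≤ H) :
    (a / b).im ^ 2 ≤ 2 * H * (H + 1) / β * (‖a‖ + ‖b‖ - ‖a + b‖) := by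
  have hb0 : b ≠ 0 := norm_pos_iff.1 (hβ.trans_le hb)
  set q := a / b with hq
  have ha : a = q * b := by rw [hq]; field_simp
  have hsum : a + b = (q + 1) * b := by rw [ha]; ring
  have htri : ‖q + 1‖ ≤ ‖q‖ + 1 := by simpa using norm_add_le q 1
  have hnn := norm_nonneg q
  have hsq : ‖q‖ ^ 2 = q.re ^ 2 + q.im ^ 2 := by
    rw [Complex.sq_norm, Complex.normSq_apply]; ring
  have hsq1 : ‖q + 1‖ ^ 2 = (q.re + 1) ^ 2 + q.im ^ 2 := by
    rw [Complex.sq_norm, Complex.normSq_apply]; simp; ring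
  have hre : |q.re| ≤ ‖q‖ := Complex.abs_re_le_norm q
  have hre' := abs_le.1 hre
  have hdef : ‖a‖ + ‖b‖ - ‖a + b‖ = (‖q‖ + 1 - ‖q + 1‖) * ‖b‖ := by
    rw [hsum, norm_mul, ha, norm_mul]; ring
  -- `(Im q)² = (|q| - Re q) (|q| + Re q)`, and `2 (|q| - Re q)` is the difference of the squares
  -- of `|q| + 1` and `|q + 1|`.
  have h1 : q.im ^ 2 ≤ (2 * (‖q‖ - q.re)) * ‖q‖ := by nlinarith
  have h2 : 2 * (‖q‖ - q.re) ≤ (‖q‖ + 1 - ‖q + 1‖) * (2 * (H + 1)) := by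
    have : 2 * (‖q‖ - q.re) = (‖q‖ + 1 - ‖q + 1‖) * (‖q‖ + 1 + ‖q + 1‖) := by nlinarith
    rw [this]
    apply mul_le_mul_of_nonneg_left _ (by linarith)
    linarith
  have h3 : q.im ^ 2 ≤ (‖q‖ + 1 - ‖q + 1‖) * (2 * (H + 1)) * H := by
    refine h1.trans (mul_le_mul h2 hH hnn ?_)
    exact mul_nonneg (by linarith) (by linarith)
  have hH0 : 0 ≤ H := hnn.trans hH
  calc q.im ^ 2 ≤ 2 * H * (H + 1) * (‖q‖ + 1 - ‖q + 1‖) := by linarith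
    _ = 2 * H * (H + 1) / β * ((‖q‖ + 1 - ‖q + 1‖) * β) := by field_simp
    _ ≤ 2 * H * (H + 1) / β * ((‖q‖ + 1 - ‖q + 1‖) * ‖b‖) := by
        apply mul_le_mul_of_nonneg_left _ (by positivity)
        exact mul_le_mul_of_nonneg_left hb (by linarith)
    _ = _ := by rw [hdef]

/-- The quotient of two holomorphic functions without zeros has a small derivative when the
triangle inequality for their `L¹` norms is almost an equality. -/
lemma exists_norm_fderiv_div_le (n : ℕ) {A β ρ : ℝ} (hA : 0 < A) (hβ : 0 < β) (hρ : 0 < ρ) :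
    ∃ C : ℝ, 0 < C ∧ ∀ (x : Cn n) (f g : Cn n → ℂ) (D : ℝ),
      DifferentiableOn ℂ f (Metric.ball x ρ) → DifferentiableOn ℂ g (Metric.ball x ρ) →
      (∀ w ∈ Metric.ball x ρ, ‖f w‖ ≤ A ∧ β ≤ ‖g w‖) →
      (∀ y r, Metric.closedBall y r ⊆ Metric.ball x ρ →
        ∫ w in Metric.closedBall y r, (‖f w‖ + ‖g w‖ - ‖f w + g w‖) ≤ D) →
      ‖fderiv ℂ (fun w => f w / g w) x‖ ≤ C * √D := by
  set V := volume.real (Metric.closedBall (0 : Cn n) (ρ / 4)) with hV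
  have hVpos : 0 < V := ENNReal.toReal_pos
    (Metric.measure_closedBall_pos _ _ (by positivity)).ne' measure_closedBall_lt_top.ne
  set H := A / β
  have hH : 0 < H := by positivity
  set B := 2 * H * (H + 1) / β with hB
  have hBpos : 0 < B := by positivity
  refine ⟨2 * Real.exp 2 * √(B / V) / (ρ / 2), by positivity, ?_⟩
  intro x f g D hf hg hfg hD
  set h : Cn n → ℂ := fun w => f w / g w with hh
  have hg0 : ∀ w ∈ Metric.ball x ρ, g w ≠ 0 := fun w hw =>
    norm_pos_iff.1 (hβ.trans_le (hfg w hw).2)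
  have hhd : DifferentiableOn ℂ h (Metric.ball x ρ) := by
    simp only [hh, div_eq_mul_inv]
    exact hf.mul (hg.inv hg0)
  have him : ∀ w ∈ Metric.ball x (ρ / 2), |(h w).im| ≤ √(B / V) * √D := by
    intro w hw
    have hball : Metric.ball w (ρ / 2) ⊆ Metric.ball x ρ :=
      Metric.ball_subset_ball' (by have : dist w x < ρ / 2 := hw; linarith)
    have hcb : Metric.closedBall w (ρ / 4) ⊆ Metric.ball x ρ :=
      (Metric.closedBall_subset_ball (by linarith)).trans hball
    have hcont : ContinuousOn (fun w => ‖f w‖ + ‖g w‖ - ‖f w + g w‖)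
        (Metric.closedBall w (ρ / 4)) := by
      have h1 := hf.continuousOn.mono hcb
      have h2 := hg.continuousOn.mono hcb
      fun_prop
    have hcont' : ContinuousOn (fun w => (h w).im ^ 2) (Metric.closedBall w (ρ / 4)) :=
      (Complex.continuous_im.comp_continuousOn (hhd.continuousOn.mono hcb)).pow 2
    have hK := isCompact_closedBall w (ρ / 4)
    have h1 := volume_closedBall_mul_im_sq_le (by linarith : ρ / 4 < ρ / 2) (hhd.mono hball)
    have h2 : ∫ w in Metric.closedBall w (ρ / 4), (h w).im ^ 2 ≤
        ∫ w in Metric.closedBall w (ρ / 4), B * (‖f w‖ + ‖g w‖ - ‖f w + g w‖) := by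
      refine setIntegral_mono_on (hcont'.integrableOn_compact hK)
        ((hcont.integrableOn_compact hK).const_mul B) measurableSet_closedBall fun v hv => ?_
      refine im_div_sq_le hβ (hfg v (hcb hv)).2 ?_
      rw [norm_div]
      exact div_le_div₀ hA.le (hfg v (hcb hv)).1 hβ (hfg v (hcb hv)).2
    rw [integral_const_mul] at h2
    have h3 := mul_le_mul_of_nonneg_left (hD w (ρ / 4) hcb) hBpos.le
    have h4 : (h w).im ^ 2 ≤ B / V * D := by
      rw [div_mul_eq_mul_div, le_div_iff₀ hVpos]
      linarith
    rw [← Real.sqrt_mul (by positivity), ← Real.sqrt_sq_eq_abs]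
    exact Real.sqrt_le_sqrt h4
  have := norm_fderiv_le_of_abs_im_le (by positivity : 0 < ρ / 2) (by positivity)
    (hhd.mono (Metric.ball_subset_ball (by linarith))) him
  refine this.trans (le_of_eq (by ring))

/-! ### The space `A¹(Ω)` -/

section BergmanOne

variable {n : ℕ} {Ω : Set (Cn n)} {f g : Cn n → ℂ}

lemma bergmanNorm_one (Ω : Set (Cn n)) (f : Cn n → ℂ) :
    bergmanNorm Ω 1 f = ∫ ζ in Ω, ‖f ζ‖ := by
  simp [bergmanNorm]

lemma mem_bergmanSpace_one_iff (hΩ : IsOpen Ω) :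
    f ∈ bergmanSpace Ω 1 ↔
      DifferentiableOn ℂ f Ω ∧ (∀ ζ, ζ ∉ Ω → f ζ = 0) ∧ IntegrableOn f Ω := by
  simp only [bergmanSpace, Set.mem_ofPred_eq, Real.rpow_one]
  refine and_congr_right fun hd => and_congr_right fun _ => ?_
  exact integrable_norm_iff (hd.continuousOn.aestronglyMeasurable hΩ.measurableSet)

lemma add_mem_bergmanSpace_one (hΩ : IsOpen Ω) (hf : f ∈ bergmanSpace Ω 1)
    (hg : g ∈ bergmanSpace Ω 1) : (fun ζ => f ζ + g ζ) ∈ bergmanSpace Ω 1 := by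
  rw [mem_bergmanSpace_one_iff hΩ] at *
  exact ⟨hf.1.add hg.1, fun ζ hζ => by simp [hf.2.1 ζ hζ, hg.2.1 ζ hζ], hf.2.2.add hg.2.2⟩

lemma const_mul_mem_bergmanSpace_one (hΩ : IsOpen Ω) (hf : f ∈ bergmanSpace Ω 1) (c : ℂ) :
    (fun ζ => c * f ζ) ∈ bergmanSpace Ω 1 := by
  rw [mem_bergmanSpace_one_iff hΩ] at *
  exact ⟨hf.1.const_mul c, fun ζ hζ => by simp [hf.2.1 ζ hζ], hf.2.2.const_mul c⟩

lemma sub_mem_bergmanSpace_one (hΩ : IsOpen Ω) (hf : f ∈ bergmanSpace Ω 1)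
    (hg : g ∈ bergmanSpace Ω 1) : (fun ζ => f ζ - g ζ) ∈ bergmanSpace Ω 1 := by
  rw [mem_bergmanSpace_one_iff hΩ] at *
  exact ⟨hf.1.sub hg.1, fun ζ hζ => by simp [hf.2.1 ζ hζ, hg.2.1 ζ hζ], hf.2.2.sub hg.2.2⟩

lemma indicator_one_mem_bergmanSpace_one (hΩ : IsOpen Ω) (hb : Bornology.IsBounded Ω) :
    Ω.indicator (fun _ => (1 : ℂ)) ∈ bergmanSpace Ω 1 := by
  rw [mem_bergmanSpace_one_iff hΩ]
  refine ⟨(differentiableOn_const 1).congr fun ζ hζ => by simp [hζ], fun ζ hζ => by simp [hζ], ?_⟩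
  refine IntegrableOn.congr_fun (f := fun _ => (1 : ℂ)) ?_ (fun ζ hζ => by simp [hζ])
    hΩ.measurableSet
  exact integrableOn_const hb.measure_lt_top.ne

lemma integral_norm_const_mul (c : ℂ) (f : Cn n → ℂ) :
    ∫ ζ in Ω, ‖c * f ζ‖ = ‖c‖ * ∫ ζ in Ω, ‖f ζ‖ := by
  simp_rw [norm_mul]
  exact integral_const_mul _ _

/-- Point evaluations are bounded on `A¹(Ω)`, with a constant depending only on the distance to
the complement of `Ω`. -/
lemma norm_le_inv_volume_mul_integral {x : Cn n} {r : ℝ} (hr : 0 < r)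
    (hx : Metric.ball x (2 * r) ⊆ Ω) (hΩ : IsOpen Ω) (hf : f ∈ bergmanSpace Ω 1) :
    ‖f x‖ ≤ (volume.real (Metric.closedBall (0 : Cn n) r))⁻¹ * ∫ ζ in Ω, ‖f ζ‖ := by
  rw [mem_bergmanSpace_one_iff hΩ] at hf
  have hV : 0 < volume.real (Metric.closedBall (0 : Cn n) r) := ENNReal.toReal_pos
    (Metric.measure_closedBall_pos _ _ hr).ne' measure_closedBall_lt_top.ne
  rw [le_inv_mul_iff₀ hV]
  refine (volume_closedBall_mul_norm_le (by linarith : r < 2 * r) (hf.1.mono hx)).trans ?_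
  refine setIntegral_mono_set hf.2.2.norm (ae_of_all _ fun _ => norm_nonneg _) ?_
  exact ((Metric.closedBall_subset_ball (by linarith)).trans hx).eventuallyLE

end BergmanOne

/-! ### Compactness -/

/-- Arzelà–Ascoli along an ultrafilter: a pointwise bounded and locally equi-Lipschitz family
converges locally uniformly. -/
lemma exists_tendstoLocallyUniformlyOn_ultrafilter {ι X F : Type*} [PseudoMetricSpace X]
    [NormedAddCommGroup F] [ProperSpace F] (U : Ultrafilter ι) (G : ι → X → F) (s : Set X)
    (h : ∀ x ∈ s, ∃ r > 0, ∃ C : ℝ, ∀ i, ‖G i x‖ ≤ C ∧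
      ∀ y ∈ Metric.ball x r, ‖G i y - G i x‖ ≤ C * dist y x) :
    ∃ g : X → F, (∀ x ∈ s, Tendsto (fun i => G i x) U (𝓝 (g x))) ∧
      TendstoLocallyUniformlyOn G g U s := by
  have hex : ∀ x, ∃ y, x ∈ s → Tendsto (fun i => G i x) U (𝓝 y) := by
    intro x
    by_cases hx : x ∈ s
    · obtain ⟨r, -, C, hC⟩ := h x hx
      obtain ⟨y, -, hy⟩ := (isCompact_closedBall (0 : F) C).ultrafilter_le_nhds
        (U.map fun i => G i x) (by
          rw [le_principal_iff]
          exact mem_map.2 (Eventually.of_forall fun i => by simpa using (hC i).1))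
      exact ⟨y, fun _ => hy⟩
    · exact ⟨0, fun hx' => absurd hx' hx⟩
  choose g hg using hex
  refine ⟨g, hg, tendstoLocallyUniformlyOn_iff_forall_tendsto.2 fun x hx => ?_⟩
  obtain ⟨r, hr, C, hC⟩ := h x hx
  have hlip : ∀ y ∈ s ∩ Metric.ball x r, ‖g y - g x‖ ≤ C * dist y x := fun y hy =>
    le_of_tendsto ((hg y hy.1).sub (hg x hx)).norm
      (Eventually.of_forall fun i => (hC i).2 y hy.2)
  rw [tendsto_uniformity_iff_dist_tendsto_zero]
  have hfst : Tendsto (fun q : ι × X => q.1) ((U : Filter ι) ×ˢ 𝓝[s] x) U := tendsto_fst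
  have hsnd : Tendsto (fun q : ι × X => q.2) ((U : Filter ι) ×ˢ 𝓝[s] x) (𝓝[s] x) := tendsto_snd
  have hbound : Tendsto (fun q : ι × X => 2 * C * dist q.2 x + ‖G q.1 x - g x‖)
      ((U : Filter ι) ×ˢ 𝓝[s] x) (𝓝 0) := by
    have h1 : Tendsto (fun q : ι × X => dist q.2 x) ((U : Filter ι) ×ˢ 𝓝[s] x) (𝓝 0) :=
      tendsto_iff_dist_tendsto_zero.1 (hsnd.mono_right nhdsWithin_le_nhds)
    have h2 : Tendsto (fun i => ‖G i x - g x‖) U (𝓝 0) :=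
      tendsto_iff_norm_sub_tendsto_zero.1 (hg x hx)
    simpa using (h1.const_mul (2 * C)).add (h2.comp hfst)
  refine squeeze_zero' (Eventually.of_forall fun _ => dist_nonneg) ?_ hbound
  have hev : ∀ᶠ y in 𝓝[s] x, y ∈ s ∩ Metric.ball x r :=
    inter_mem self_mem_nhdsWithin (mem_nhdsWithin_of_mem_nhds (Metric.ball_mem_nhds x hr))
  filter_upwards [hsnd.eventually hev] with q hq
  have h1 := hlip q.2 hq
  have h2 := (hC q.1).2 q.2 hq.2
  have hsplit : g q.2 - G q.1 q.2 =
      (g q.2 - g x) - (G q.1 q.2 - G q.1 x) - (G q.1 x - g x) := by abel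
  rw [dist_eq_norm, hsplit]
  refine (norm_sub_le _ _).trans ?_
  linarith [norm_sub_le (g q.2 - g x) (G q.1 q.2 - G q.1 x)]

/-- Integrals over an open set of finite measure are controlled by those over compact subsets. -/
lemma setIntegral_norm_le_of_forall_isCompact {n : ℕ} {Ω : Set (Cn n)} (hΩ : IsOpen Ω)
    (hb : Bornology.IsBounded Ω) {f : Cn n → ℂ} (hf : ContinuousOn f Ω) {L : ℝ}
    (hK : ∀ K ⊆ Ω, IsCompact K → ∫ ζ in K, ‖f ζ‖ ≤ L) :
    IntegrableOn f Ω ∧ ∫ ζ in Ω, ‖f ζ‖ ≤ L := by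
  have hmeas := hf.aestronglyMeasurable (μ := volume) hΩ.measurableSet
  have hL : 0 ≤ L := by simpa using hK ∅ (Set.empty_subset _) isCompact_empty
  obtain ⟨F, hFclosed, hFsub, hFU, hFmono⟩ := hΩ.exists_iUnion_isClosed
  have hlin : ∫⁻ ζ in Ω, ‖f ζ‖ₑ ≤ ENNReal.ofReal L := by
    rw [← hFU, setLIntegral_iUnion_of_directed _ hFmono.directed_le]
    refine iSup_le fun k => ?_
    have hcomp : IsCompact (F k) :=
      Metric.isCompact_of_isClosed_isBounded (hFclosed k) (hb.subset (hFsub k))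
    have hint : IntegrableOn f (F k) := (hf.mono (hFsub k)).integrableOn_compact hcomp
    rw [← ofReal_integral_norm_eq_lintegral_enorm hint]
    exact ENNReal.ofReal_le_ofReal (hK _ (hFsub k) hcomp)
  have hint : IntegrableOn f Ω := ⟨hmeas, hlin.trans_lt ENNReal.ofReal_lt_top⟩
  refine ⟨hint, ?_⟩
  rw [← ofReal_integral_norm_eq_lintegral_enorm hint] at hlin
  exact (ENNReal.ofReal_le_ofReal_iff hL).1 hlin

/-- Montel's theorem for bounded families in `A¹(Ω)`, along an ultrafilter, together with lower
semicontinuity of the norm. Evaluations at points moving with the index converge as well. -/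
lemma exists_tendsto_of_integral_norm_le {n : ℕ} {Ω : Set (Cn n)} (hΩ : IsOpen Ω)
    (hb : Bornology.IsBounded Ω) {ι : Type*} (U : Ultrafilter ι) (F : ι → Cn n → ℂ) (M : ℝ)
    (hF : ∀ i, F i ∈ bergmanSpace Ω 1) (hM : ∀ i, ∫ ζ in Ω, ‖F i ζ‖ ≤ M) :
    ∃ f ∈ bergmanSpace Ω 1,
      (∀ x ∈ Ω, ∀ w : ι → Cn n, Tendsto w U (𝓝 x) → Tendsto (fun i => F i (w i)) U (𝓝 (f x))) ∧
      ∀ L : ℝ, (∀ᶠ i in (U : Filter ι), ∫ ζ in Ω, ‖F i ζ‖ ≤ L) → ∫ ζ in Ω, ‖f ζ‖ ≤ L := by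
  have hFd : ∀ i, DifferentiableOn ℂ (F i) Ω := fun i => (hF i).1
  -- uniform bounds on a ball of radius `2 r` around each point
  have hloc : ∀ x ∈ Ω, ∃ r > 0, ∃ B : ℝ, 0 ≤ B ∧ Metric.ball x (2 * r) ⊆ Ω ∧
      ∀ i, ∀ w ∈ Metric.ball x (2 * r), ‖F i w‖ ≤ B := by
    intro x hx
    obtain ⟨R, hR, hball⟩ := Metric.isOpen_iff.1 hΩ x hx
    have hM0 : 0 ≤ M := by
      obtain ⟨i⟩ : Nonempty ι := nonempty_of_neBot (U : Filter ι)
      exact (integral_nonneg fun _ => norm_nonneg _).trans (hM i)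
    refine ⟨R / 4, by positivity,
      (volume.real (Metric.closedBall (0 : Cn n) (R / 4)))⁻¹ * M,
      mul_nonneg (inv_nonneg.2 measureReal_nonneg) hM0,
      (Metric.ball_subset_ball (by linarith)).trans hball, fun i w hw => ?_⟩
    have hw' : Metric.ball w (2 * (R / 4)) ⊆ Ω := (Metric.ball_subset_ball' (by
      have : dist w x < 2 * (R / 4) := hw
      linarith)).trans hball
    refine (norm_le_inv_volume_mul_integral (by positivity) hw' hΩ (hF i)).trans ?_
    exact mul_le_mul_of_nonneg_left (hM i) (inv_nonneg.2 measureReal_nonneg)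
  obtain ⟨g, hg, hgu⟩ := exists_tendstoLocallyUniformlyOn_ultrafilter U F Ω (by
    intro x hx
    obtain ⟨r, hr, B, hB, hsub, hbd⟩ := hloc x hx
    refine ⟨2 * r, by positivity, max B (2 * B / (2 * r)), fun i =>
      ⟨(hbd i x (Metric.mem_ball_self (by positivity))).trans (le_max_left _ _), fun y hy => ?_⟩⟩
    rw [dist_eq_norm]
    exact (norm_sub_le_of_norm_le ((hFd i).mono hsub) (hbd i) hy).trans
      (mul_le_mul_of_nonneg_right (le_max_right _ _) (norm_nonneg _)))
  have : ProperSpace (Cn n →L[ℂ] ℂ) := FiniteDimensional.proper ℂ _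
  obtain ⟨g', -, hgu'⟩ := exists_tendstoLocallyUniformlyOn_ultrafilter U
    (fun i => fderiv ℂ (F i)) Ω (by
    intro x hx
    obtain ⟨r, hr, B, hB, hsub, hbd⟩ := hloc x hx
    refine ⟨r, hr, max (2 * B / (2 * r)) (4 * B / r ^ 2), fun i =>
      ⟨(norm_fderiv_le_of_norm_le (by positivity) ((hFd i).mono hsub) (hbd i)).trans
        (le_max_left _ _), fun y hy => ?_⟩⟩
    rw [dist_eq_norm]
    exact (norm_fderiv_sub_fderiv_le hr ((hFd i).mono hsub) (hbd i) hy).trans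
      (mul_le_mul_of_nonneg_right (le_max_right _ _) (norm_nonneg _)))
  have hgd : DifferentiableOn ℂ g Ω := fun x hx =>
    (hasFDerivAt_of_tendstoLocallyUniformlyOn hΩ hgu'
      (fun i y hy => ((hFd i).differentiableAt (hΩ.mem_nhds hy)).hasFDerivAt) hg
      hx).differentiableAt.differentiableWithinAt
  have hnorm : ∀ L : ℝ, (∀ᶠ i in (U : Filter ι), ∫ ζ in Ω, ‖F i ζ‖ ≤ L) →
      IntegrableOn g Ω ∧ ∫ ζ in Ω, ‖g ζ‖ ≤ L := by
    intro L hL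
    refine setIntegral_norm_le_of_forall_isCompact hΩ hb hgd.continuousOn fun K hKΩ hK => ?_
    have hunif := (tendstoLocallyUniformlyOn_iff_forall_isCompact hΩ).1 hgu K hKΩ hK
    have hKfin : volume K ≠ ⊤ := hK.measure_lt_top.ne
    have hgK : IntegrableOn g K := (hgd.continuousOn.mono hKΩ).integrableOn_compact hK
    have hε : ∀ ε : ℝ, 0 < ε → ∫ ζ in K, ‖g ζ‖ ≤ L + ε * volume.real K := by
      intro ε hε
      obtain ⟨i, hi, hiL⟩ := ((Metric.tendstoUniformlyOn_iff.1 hunif ε hε).and hL).exists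
      have hFΩ := ((mem_bergmanSpace_one_iff hΩ).1 (hF i)).2.2
      calc ∫ ζ in K, ‖g ζ‖ ≤ ∫ ζ in K, (‖F i ζ‖ + ε) := by
            refine setIntegral_mono_on hgK.norm
              ((hFΩ.mono_set hKΩ).norm.add (integrableOn_const hKfin)) hK.measurableSet
              fun ζ hζ => ?_
            have h1 := hi ζ hζ
            rw [dist_eq_norm] at h1
            linarith [norm_sub_norm_le (g ζ) (F i ζ)]
        _ = (∫ ζ in K, ‖F i ζ‖) + ε * volume.real K := by
            rw [integral_add (hFΩ.mono_set hKΩ).norm (integrableOn_const hKfin),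
              setIntegral_const, smul_eq_mul, mul_comm]
        _ ≤ L + ε * volume.real K := by
            have : ∫ ζ in K, ‖F i ζ‖ ≤ ∫ ζ in Ω, ‖F i ζ‖ :=
              setIntegral_mono_set hFΩ.norm (ae_of_all _ fun _ => norm_nonneg _)
                hKΩ.eventuallyLE
            linarith
    have hlim : Tendsto (fun ε : ℝ => L + ε * volume.real K) (𝓝[>] 0) (𝓝 L) := by
      have : Continuous fun ε : ℝ => L + ε * volume.real K := by fun_prop
      simpa using (this.tendsto 0).mono_left nhdsWithin_le_nhds
    exact ge_of_tendsto hlim (by filter_upwards [self_mem_nhdsWithin] with ε hε' using hε ε hε')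
  have hcongr : Set.EqOn (Ω.indicator g) g Ω := fun ζ hζ => Set.indicator_of_mem hζ g
  have hint : ∫ ζ in Ω, ‖Ω.indicator g ζ‖ = ∫ ζ in Ω, ‖g ζ‖ :=
    setIntegral_congr_fun hΩ.measurableSet fun ζ hζ => by simp [hζ]
  refine ⟨Ω.indicator g, (mem_bergmanSpace_one_iff hΩ).2 ⟨hgd.congr hcongr,
    fun ζ hζ => Set.indicator_of_notMem hζ g,
    ((hnorm M (Eventually.of_forall hM)).1).congr_fun hcongr.symm hΩ.measurableSet⟩, ?_, ?_⟩
  · intro x hx w hw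
    rw [hcongr hx]
    refine hgu.tendsto_comp (hgd.continuousOn x hx) hx ?_
    rw [hΩ.nhdsWithin_eq hx]
    exact hw
  · intro L hL
    rw [hint]
    exact (hnorm L hL).2

/-! ### Extremal functions -/

section Extremal

variable {n : ℕ} {Ω : Set (Cn n)} {f g : Cn n → ℂ} {z : Cn n}

lemma exists_isBergmanMinimizer_one (hΩ : IsOpen Ω) (hb : Bornology.IsBounded Ω) (hz : z ∈ Ω) :
    ∃ m, IsBergmanMinimizer Ω 1 z m := by
  set S : Set ℝ := {t | ∃ f ∈ bergmanSpace Ω 1, f z = 1 ∧ ∫ ζ in Ω, ‖f ζ‖ = t} with hS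
  have hne : S.Nonempty :=
    ⟨_, _, indicator_one_mem_bergmanSpace_one hΩ hb, by simp [hz], rfl⟩
  have hbdd : BddBelow S := ⟨0, by
    rintro t ⟨f, -, -, rfl⟩
    exact integral_nonneg fun _ => norm_nonneg _⟩
  obtain ⟨u, hanti, hu, huS⟩ := exists_seq_tendsto_sInf hne hbdd
  choose F hF hFz hFu using huS
  obtain ⟨f, hf, heval, hnorm⟩ := exists_tendsto_of_integral_norm_le hΩ hb (hyperfilter ℕ) F (u 0)
    hF fun i => (hFu i).trans_le (hanti (Nat.zero_le i))
  have hfz : f z = 1 := by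
    have := heval z hz (fun _ => z) tendsto_const_nhds
    simp only [hFz] at this
    exact tendsto_nhds_unique this tendsto_const_nhds
  have hmin : ∫ ζ in Ω, ‖f ζ‖ ≤ sInf S := by
    refine le_of_forall_gt_imp_ge_of_dense fun L hL => hnorm L ?_
    have := Nat.hyperfilter_le_atTop (hu.eventually_lt_const hL)
    filter_upwards [this] with i hi
    exact (hFu i).trans_le (le_of_lt hi)
  refine ⟨f, hf, hfz, fun g hg hgz => ?_⟩
  rw [bergmanNorm_one, bergmanNorm_one]
  exact hmin.trans (csInf_le hbdd ⟨g, hg, hgz, rfl⟩)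

lemma isBergmanMinimizer_bergmanMinimizer_one (hΩ : IsOpen Ω) (hb : Bornology.IsBounded Ω)
    (hz : z ∈ Ω) : IsBergmanMinimizer Ω 1 z (bergmanMinimizer Ω 1 z) :=
  Classical.epsilon_spec (exists_isBergmanMinimizer_one hΩ hb hz)

lemma exists_ball_two_mul_subset (hΩ : IsOpen Ω) (hz : z ∈ Ω) :
    ∃ r > 0, Metric.ball z (2 * r) ⊆ Ω := by
  obtain ⟨R, hR, h⟩ := Metric.isOpen_iff.1 hΩ z hz
  exact ⟨R / 2, by positivity, by rwa [mul_div_cancel₀ _ two_ne_zero]⟩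

lemma integral_norm_pos_of_ne_zero (hΩ : IsOpen Ω) (hz : z ∈ Ω) (hf : f ∈ bergmanSpace Ω 1)
    (hfz : f z ≠ 0) : 0 < ∫ ζ in Ω, ‖f ζ‖ := by
  obtain ⟨r, hr, hball⟩ := exists_ball_two_mul_subset hΩ hz
  have h := (norm_pos_iff.2 hfz).trans_le (norm_le_inv_volume_mul_integral hr hball hΩ hf)
  exact pos_of_mul_pos_right h (inv_nonneg.2 measureReal_nonneg)

lemma integral_norm_bergmanMinimizer_pos (hΩ : IsOpen Ω) (hb : Bornology.IsBounded Ω)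
    (hz : z ∈ Ω) : 0 < ∫ ζ in Ω, ‖bergmanMinimizer Ω 1 z ζ‖ := by
  have hm := isBergmanMinimizer_bergmanMinimizer_one hΩ hb hz
  exact integral_norm_pos_of_ne_zero hΩ hz hm.1 (by rw [hm.2.1]; exact one_ne_zero)

lemma norm_mul_integral_bergmanMinimizer_le (hΩ : IsOpen Ω) (hb : Bornology.IsBounded Ω)
    (hz : z ∈ Ω) (hf : f ∈ bergmanSpace Ω 1) :
    ‖f z‖ * ∫ ζ in Ω, ‖bergmanMinimizer Ω 1 z ζ‖ ≤ ∫ ζ in Ω, ‖f ζ‖ := by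
  have hm := isBergmanMinimizer_bergmanMinimizer_one hΩ hb hz
  rcases eq_or_ne (f z) 0 with h0 | h0
  · rw [h0, norm_zero, zero_mul]
    exact integral_nonneg fun _ => norm_nonneg _
  · have h := hm.2.2 _ (const_mul_mem_bergmanSpace_one hΩ hf (f z)⁻¹) (inv_mul_cancel₀ h0)
    rwa [bergmanNorm_one, bergmanNorm_one, integral_norm_const_mul, norm_inv,
      le_inv_mul_iff₀ (norm_pos_iff.2 h0)] at h

lemma bergmanKernelDiag_one_eq (hΩ : IsOpen Ω) (hb : Bornology.IsBounded Ω) (hz : z ∈ Ω) :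
    bergmanKernelDiag Ω 1 z = (∫ ζ in Ω, ‖bergmanMinimizer Ω 1 z ζ‖)⁻¹ := by
  have hm := isBergmanMinimizer_bergmanMinimizer_one hΩ hb hz
  have hpos := integral_norm_bergmanMinimizer_pos hΩ hb hz
  refine IsGreatest.csSup_eq ⟨?_, ?_⟩
  · refine ⟨_, const_mul_mem_bergmanSpace_one hΩ hm.1
      ((∫ ζ in Ω, ‖bergmanMinimizer Ω 1 z ζ‖ : ℝ) : ℂ)⁻¹, ?_, ?_⟩
    · rw [bergmanNorm_one, integral_norm_const_mul, norm_inv, Complex.norm_real,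
        Real.norm_of_nonneg hpos.le, inv_mul_cancel₀ hpos.ne']
    · rw [hm.2.1, mul_one, Real.rpow_one, norm_inv, Complex.norm_real,
        Real.norm_of_nonneg hpos.le]
  · rintro t ⟨f, hf, hf1, rfl⟩
    rw [bergmanNorm_one] at hf1
    rw [Real.rpow_one, ← one_div, le_div_iff₀ hpos]
    exact (norm_mul_integral_bergmanMinimizer_le hΩ hb hz hf).trans_eq hf1

lemma bergmanKernelDiag_one_pos (hΩ : IsOpen Ω) (hb : Bornology.IsBounded Ω) (hz : z ∈ Ω) :
    0 < bergmanKernelDiag Ω 1 z := by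
  rw [bergmanKernelDiag_one_eq hΩ hb hz]
  exact inv_pos.2 (integral_norm_bergmanMinimizer_pos hΩ hb hz)

lemma norm_le_bergmanKernelDiag_mul (hΩ : IsOpen Ω) (hb : Bornology.IsBounded Ω) (hz : z ∈ Ω)
    (hf : f ∈ bergmanSpace Ω 1) : ‖f z‖ ≤ bergmanKernelDiag Ω 1 z * ∫ ζ in Ω, ‖f ζ‖ := by
  rw [bergmanKernelDiag_one_eq hΩ hb hz,
    le_inv_mul_iff₀ (integral_norm_bergmanMinimizer_pos hΩ hb hz), mul_comm]
  exact norm_mul_integral_bergmanMinimizer_le hΩ hb hz hf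

lemma inv_volume_le_bergmanKernelDiag (hΩ : IsOpen Ω) (hb : Bornology.IsBounded Ω)
    (hz : z ∈ Ω) : (volume.real Ω)⁻¹ ≤ bergmanKernelDiag Ω 1 z := by
  have h := norm_le_bergmanKernelDiag_mul hΩ hb hz (indicator_one_mem_bergmanSpace_one hΩ hb)
  have hint : ∫ ζ in Ω, ‖Ω.indicator (fun _ => (1 : ℂ)) ζ‖ = volume.real Ω := by
    rw [setIntegral_congr_fun (g := fun _ => (1 : ℝ)) hΩ.measurableSet fun ζ hζ => by simp [hζ]]
    simp
  rw [hint, Set.indicator_of_mem hz, norm_one] at h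
  have hK := bergmanKernelDiag_one_pos hΩ hb hz
  have hV : 0 < volume.real Ω := pos_of_mul_pos_right (one_pos.trans_le h) hK.le
  rwa [inv_le_iff_one_le_mul₀ hV]

lemma bergmanKernel_mem (hΩ : IsOpen Ω) (hb : Bornology.IsBounded Ω) (hz : z ∈ Ω) :
    (fun ζ => bergmanKernel Ω 1 ζ z) ∈ bergmanSpace Ω 1 := by
  simp only [bergmanKernel, mul_comm _ (bergmanKernelDiag Ω 1 z : ℂ)]
  exact const_mul_mem_bergmanSpace_one hΩ (isBergmanMinimizer_bergmanMinimizer_one hΩ hb hz).1 _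

lemma bergmanKernel_self (hΩ : IsOpen Ω) (hb : Bornology.IsBounded Ω) (hz : z ∈ Ω) :
    bergmanKernel Ω 1 z z = bergmanKernelDiag Ω 1 z := by
  rw [bergmanKernel, (isBergmanMinimizer_bergmanMinimizer_one hΩ hb hz).2.1, one_mul]

lemma integral_norm_bergmanKernel (hΩ : IsOpen Ω) (hb : Bornology.IsBounded Ω) (hz : z ∈ Ω) :
    ∫ ζ in Ω, ‖bergmanKernel Ω 1 ζ z‖ = 1 := by
  have hpos := integral_norm_bergmanMinimizer_pos hΩ hb hz
  simp only [bergmanKernel, mul_comm _ (bergmanKernelDiag Ω 1 z : ℂ)]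
  rw [integral_norm_const_mul, bergmanKernelDiag_one_eq hΩ hb hz, Complex.norm_real,
    Real.norm_of_nonneg (inv_nonneg.2 hpos.le), inv_mul_cancel₀ hpos.ne']

/-- The part of the defect in the triangle inequality `‖f + g‖₁ ≤ ‖f‖₁ + ‖g‖₁` carried by a subset
of `Ω` is at most the whole defect. -/
lemma setIntegral_defect_le (hΩ : IsOpen Ω) (hf : f ∈ bergmanSpace Ω 1)
    (hg : g ∈ bergmanSpace Ω 1) {s : Set (Cn n)} (hs : s ⊆ Ω) :
    ∫ ζ in s, (‖f ζ‖ + ‖g ζ‖ - ‖f ζ + g ζ‖) ≤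
      (∫ ζ in Ω, ‖f ζ‖) + (∫ ζ in Ω, ‖g ζ‖) - ∫ ζ in Ω, ‖f ζ + g ζ‖ := by
  have hf' := ((mem_bergmanSpace_one_iff hΩ).1 hf).2.2
  have hg' := ((mem_bergmanSpace_one_iff hΩ).1 hg).2.2
  have hfg : Integrable (fun ζ => ‖f ζ‖ + ‖g ζ‖) (volume.restrict Ω) := hf'.norm.add hg'.norm
  have hsum : Integrable (fun ζ => ‖f ζ + g ζ‖) (volume.restrict Ω) := (hf'.add hg').norm
  rw [← integral_add hf'.norm hg'.norm, ← integral_sub hfg hsum]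
  refine setIntegral_mono_set (hfg.sub hsum) (ae_of_all _ fun ζ => ?_) hs.eventuallyLE
  exact sub_nonneg.2 (norm_add_le _ _)

/-- Uniqueness of extremal functions. Two of them have no defect in the triangle inequality, so
that their quotient is constant near `z`. -/
lemma eq_of_extremal (hΩ : IsOpen Ω) (hconn : IsConnected Ω) (hb : Bornology.IsBounded Ω)
    (hz : z ∈ Ω) (hf : f ∈ bergmanSpace Ω 1) (hg : g ∈ bergmanSpace Ω 1)
    (hf1 : ∫ ζ in Ω, ‖f ζ‖ ≤ 1) (hg1 : ∫ ζ in Ω, ‖g ζ‖ ≤ 1)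
    (hfz : f z = bergmanKernelDiag Ω 1 z) (hgz : g z = bergmanKernelDiag Ω 1 z) : f = g := by
  set K := bergmanKernelDiag Ω 1 z with hKdef
  have hK : 0 < K := bergmanKernelDiag_one_pos hΩ hb hz
  have hfd : DifferentiableOn ℂ f Ω := hf.1
  have hgd : DifferentiableOn ℂ g Ω := hg.1
  have hnf : ‖f z‖ = K := by rw [hfz, Complex.norm_real, Real.norm_of_nonneg hK.le]
  have hng : ‖g z‖ = K := by rw [hgz, Complex.norm_real, Real.norm_of_nonneg hK.le]
  have hdefect : (∫ ζ in Ω, ‖f ζ‖) + (∫ ζ in Ω, ‖g ζ‖) - ∫ ζ in Ω, ‖f ζ + g ζ‖ ≤ 0 := by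
    have h := norm_le_bergmanKernelDiag_mul hΩ hb hz (add_mem_bergmanSpace_one hΩ hf hg)
    rw [hfz, hgz, ← Complex.ofReal_add, Complex.norm_real, Real.norm_of_nonneg (by positivity)] at h
    have : 2 ≤ ∫ ζ in Ω, ‖f ζ + g ζ‖ := by
      refine le_of_mul_le_mul_left ?_ hK
      linarith
    linarith
  have hev : ∀ᶠ w in 𝓝 z, w ∈ Ω ∧ ‖f w‖ ≤ 2 * K ∧ K / 2 ≤ ‖g w‖ := by
    have h1 := (hfd.continuousOn.continuousAt (hΩ.mem_nhds hz)).norm.eventually_le_const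
      (by rw [hnf]; linarith : ‖f z‖ < 2 * K)
    have h2 := (hgd.continuousOn.continuousAt (hΩ.mem_nhds hz)).norm.eventually_const_le
      (by rw [hng]; linarith : K / 2 < ‖g z‖)
    filter_upwards [hΩ.mem_nhds hz, h1, h2] with w h0 h1 h2 using ⟨h0, h1, h2⟩
  obtain ⟨R, hR, hball⟩ := Metric.eventually_nhds_iff_ball.1 hev
  obtain ⟨C, -, hC⟩ := exists_norm_fderiv_div_le n (by positivity : 0 < 2 * K)
    (by positivity : 0 < K / 2) (by positivity : 0 < R / 2)
  have hder : ∀ x ∈ Metric.ball z (R / 2), fderiv ℂ (fun w => f w / g w) x = 0 := by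
    intro x hx
    have hsub : Metric.ball x (R / 2) ⊆ Metric.ball z R := Metric.ball_subset_ball' (by
      have : dist x z < R / 2 := hx
      linarith)
    have hsubΩ : Metric.ball x (R / 2) ⊆ Ω := fun w hw => (hball w (hsub hw)).1
    have h := hC x f g 0 (hfd.mono hsubΩ) (hgd.mono hsubΩ) (fun w hw => (hball w (hsub hw)).2)
      (fun y r hyr => (setIntegral_defect_le hΩ hf hg (hyr.trans hsubΩ)).trans hdefect)
    rw [Real.sqrt_zero, mul_zero] at h
    exact norm_le_zero_iff.1 h
  have hsub : Metric.ball z (R / 2) ⊆ Metric.ball z R := Metric.ball_subset_ball (by linarith)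
  have hg0 : ∀ w ∈ Metric.ball z (R / 2), g w ≠ 0 := fun w hw =>
    norm_pos_iff.1 ((by positivity : 0 < K / 2).trans_le (hball w (hsub hw)).2.2)
  have hq : DifferentiableOn ℂ (fun w => f w / g w) (Metric.ball z (R / 2)) := by
    have hsubΩ : Metric.ball z (R / 2) ⊆ Ω := fun w hw => (hball w (hsub hw)).1
    simp only [div_eq_mul_inv]
    exact (hfd.mono hsubΩ).mul ((hgd.mono hsubΩ).inv hg0)
  have hzR : z ∈ Metric.ball z (R / 2) := Metric.mem_ball_self (by positivity)
  have heq : ∀ w ∈ Metric.ball z (R / 2), f w - g w = 0 := by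
    intro w hw
    have h : f w / g w = f z / g z := Metric.isOpen_ball.is_const_of_fderiv_eq_zero
      (convex_ball z (R / 2)).isPreconnected hq hder hw hzR
    rw [hfz, hgz, div_self (by exact_mod_cast hK.ne'), div_eq_one_iff_eq (hg0 w hw)] at h
    exact sub_eq_zero.2 h
  have hall := eqOn_zero_of_eventually_eq_zero hΩ hconn.isPreconnected (hfd.sub hgd) hz
    (Filter.eventually_of_mem (Metric.ball_mem_nhds z (by positivity)) heq)
  funext ζ
  by_cases hζ : ζ ∈ Ω
  · exact sub_eq_zero.1 (hall ζ hζ)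
  · rw [hf.2.1 ζ hζ, hg.2.1 ζ hζ]

end Extremal

/-! ### Dependence of the extremal function on the point -/

section Continuity

variable {n : ℕ} {Ω : Set (Cn n)}

lemma exists_uniform_norm_le (hΩ : IsOpen Ω) {S : Set (Cn n)} (hSΩ : S ⊆ Ω) (hS : IsCompact S) :
    ∃ r > 0, ∃ A > 0, ∀ z ∈ S, Metric.ball z (2 * r) ⊆ Ω ∧
      ∀ f ∈ bergmanSpace Ω 1, ∀ w ∈ Metric.ball z (2 * r), ‖f w‖ ≤ A * ∫ ζ in Ω, ‖f ζ‖ := by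
  obtain ⟨δ, hδ, hsub⟩ := hS.exists_thickening_subset_open hΩ hSΩ
  have hball : ∀ z ∈ S, Metric.ball z δ ⊆ Ω := fun z hz =>
    (Metric.ball_subset_thickening hz δ).trans hsub
  have hV : 0 < volume.real (Metric.closedBall (0 : Cn n) (δ / 4)) := ENNReal.toReal_pos
    (Metric.measure_closedBall_pos _ _ (by positivity)).ne' measure_closedBall_lt_top.ne
  refine ⟨δ / 4, by positivity, _, inv_pos.2 hV, fun z hz =>
    ⟨(Metric.ball_subset_ball (by linarith)).trans (hball z hz), fun f hf w hw => ?_⟩⟩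
  refine norm_le_inv_volume_mul_integral (by positivity) ?_ hΩ hf
  refine (Metric.ball_subset_ball' ?_).trans (hball z hz)
  have : dist w z < 2 * (δ / 4) := hw
  linarith

lemma bergmanKernelDiag_sub_le (hΩ : IsOpen Ω) (hb : Bornology.IsBounded Ω) {z z' : Cn n}
    (hz : z ∈ Ω) (hz' : z' ∈ Ω) :
    bergmanKernelDiag Ω 1 z' - bergmanKernelDiag Ω 1 z ≤
      (bergmanKernel Ω 1 z' z' - bergmanKernel Ω 1 z z').re := by
  have h := norm_le_bergmanKernelDiag_mul hΩ hb hz (bergmanKernel_mem hΩ hb hz')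
  rw [integral_norm_bergmanKernel hΩ hb hz', mul_one] at h
  rw [Complex.sub_re, bergmanKernel_self hΩ hb hz', Complex.ofReal_re]
  linarith [Complex.re_le_norm (bergmanKernel Ω 1 z z')]

lemma abs_bergmanKernelDiag_sub_le (hΩ : IsOpen Ω) (hb : Bornology.IsBounded Ω)
    {S : Set (Cn n)} (hSΩ : S ⊆ Ω) {r A : ℝ}
    (hrA : ∀ z ∈ S, Metric.ball z (2 * r) ⊆ Ω ∧
      ∀ f ∈ bergmanSpace Ω 1, ∀ w ∈ Metric.ball z (2 * r), ‖f w‖ ≤ A * ∫ ζ in Ω, ‖f ζ‖)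
    {z z' : Cn n} (hz : z ∈ S) (hz' : z' ∈ S) (hzz' : ‖z - z'‖ < 2 * r) :
    |bergmanKernelDiag Ω 1 z - bergmanKernelDiag Ω 1 z'| ≤ A / r * ‖z - z'‖ := by
  have key : ∀ z ∈ S, ∀ z' ∈ S, ‖z - z'‖ < 2 * r →
      bergmanKernelDiag Ω 1 z' - bergmanKernelDiag Ω 1 z ≤ A / r * ‖z - z'‖ := by
    intro z hz z' hz' hzz'
    refine (bergmanKernelDiag_sub_le hΩ hb (hSΩ hz) (hSΩ hz')).trans ?_
    refine (Complex.re_le_norm _).trans ?_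
    have hk := bergmanKernel_mem hΩ hb (hSΩ hz')
    have h := norm_sub_le_of_norm_le (hk.1.mono (hrA z' hz').1) (M := A) (fun w hw => by
      have := (hrA z' hz').2 _ hk w hw
      rwa [integral_norm_bergmanKernel hΩ hb (hSΩ hz'), mul_one] at this)
      (w := z) (by rwa [Metric.mem_ball, dist_eq_norm])
    rw [norm_sub_rev]
    rwa [mul_div_mul_left _ _ two_ne_zero] at h
  refine abs_le.2 ⟨?_, ?_⟩
  · linarith [key z hz z' hz' hzz']
  · have := key z' hz' z hz (by rwa [norm_sub_rev])
    rwa [norm_sub_rev]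

lemma continuousOn_bergmanKernelDiag_one (hΩ : IsOpen Ω) (hb : Bornology.IsBounded Ω) :
    ContinuousOn (bergmanKernelDiag Ω 1) Ω := by
  intro z hz
  apply ContinuousAt.continuousWithinAt
  obtain ⟨ε, hε, hsub⟩ := Metric.nhds_basis_closedBall.mem_iff.1 (hΩ.mem_nhds hz)
  obtain ⟨r, hr, A, hA, hrA⟩ := exists_uniform_norm_le hΩ hsub (isCompact_closedBall z ε)
  rw [ContinuousAt, tendsto_iff_norm_sub_tendsto_zero]
  have hlim : Tendsto (fun w : Cn n => A / r * ‖w - z‖) (𝓝 z) (𝓝 0) := by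
    have : Continuous fun w : Cn n => A / r * ‖w - z‖ := by fun_prop
    simpa using this.tendsto z
  refine squeeze_zero' (Eventually.of_forall fun _ => norm_nonneg _) ?_ hlim
  filter_upwards [Metric.closedBall_mem_nhds z hε,
    Metric.ball_mem_nhds z (by positivity : 0 < 2 * r)] with w hw hw'
  rw [Real.norm_eq_abs]
  exact abs_bergmanKernelDiag_sub_le hΩ hb hsub hrA hw (Metric.mem_closedBall_self hε.le)
    (by rwa [← dist_eq_norm])

/-- The extremal functions converge pointwise: along any ultrafilter a limit exists by Montel's
theorem, and it is extremal by continuity of the diagonal kernel, hence unique. -/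
lemma tendsto_bergmanKernel (hΩ : IsOpen Ω) (hconn : IsConnected Ω)
    (hb : Bornology.IsBounded Ω) (z : Ω) (ζ : Cn n) :
    Tendsto (fun z' : Ω => bergmanKernel Ω 1 ζ z') (𝓝 z) (𝓝 (bergmanKernel Ω 1 ζ z)) := by
  by_cases hζ : ζ ∈ Ω
  swap
  · have h0 : ∀ z' : Ω, bergmanKernel Ω 1 ζ z' = 0 := fun z' =>
      (bergmanKernel_mem hΩ hb z'.2).2.1 ζ hζ
    simp only [h0]
    exact tendsto_const_nhds
  rw [tendsto_iff_ultrafilter]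
  intro U hU
  obtain ⟨f, hf, heval, hnorm⟩ := exists_tendsto_of_integral_norm_le hΩ hb U
    (fun z' : Ω => fun ζ => bergmanKernel Ω 1 ζ z') 1 (fun z' => bergmanKernel_mem hΩ hb z'.2)
    (fun z' => (integral_norm_bergmanKernel hΩ hb z'.2).le)
  have hf1 : ∫ ζ in Ω, ‖f ζ‖ ≤ 1 :=
    hnorm 1 (Eventually.of_forall fun z' => (integral_norm_bergmanKernel hΩ hb z'.2).le)
  have hcoe : Tendsto (fun z' : Ω => (z' : Cn n)) U (𝓝 z) :=
    (continuous_subtype_val.tendsto z).mono_left hU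
  have hdiag : Tendsto (fun z' : Ω => (bergmanKernelDiag Ω 1 z' : ℂ)) U
      (𝓝 (bergmanKernelDiag Ω 1 z : ℂ)) := by
    have h := (continuousOn_bergmanKernelDiag_one hΩ hb).domRestrict.tendsto z
    exact (Complex.continuous_ofReal.tendsto _).comp (h.mono_left hU)
  have hfz : f z = bergmanKernelDiag Ω 1 z := by
    have h := heval z z.2 _ hcoe
    simp only [bergmanKernel_self hΩ hb (Subtype.coe_prop _)] at h
    exact tendsto_nhds_unique h hdiag
  have hfk : f = fun ζ => bergmanKernel Ω 1 ζ z :=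
    eq_of_extremal hΩ hconn hb z.2 hf (bergmanKernel_mem hΩ hb z.2) hf1
      (integral_norm_bergmanKernel hΩ hb z.2).le hfz (bergmanKernel_self hΩ hb z.2)
  have h := heval ζ hζ (fun _ => ζ) tendsto_const_nhds
  rw [hfk] at h
  exact h

/-- The extremal functions depend continuously on the point in `L¹`: as they all have norm one,
pointwise convergence improves to convergence in norm. -/
lemma tendsto_integral_norm_bergmanKernel_sub (hΩ : IsOpen Ω) (hconn : IsConnected Ω)
    (hb : Bornology.IsBounded Ω) (z : Ω) :
    Tendsto (fun z' : Ω => ∫ ζ in Ω, ‖bergmanKernel Ω 1 ζ z' - bergmanKernel Ω 1 ζ z‖) (𝓝 z)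
      (𝓝 0) := by
  have hint : ∀ z' : Ω, Integrable (fun ζ => bergmanKernel Ω 1 ζ z') (volume.restrict Ω) :=
    fun z' => ((mem_bergmanSpace_one_iff hΩ).1 (bergmanKernel_mem hΩ hb z'.2)).2.2
  -- dominated convergence for `|a - b| - |a| + |b|`, which lies between `0` and `2 |b|`
  have hD : Tendsto (fun z' : Ω => ∫ ζ in Ω, (‖bergmanKernel Ω 1 ζ z' - bergmanKernel Ω 1 ζ z‖ -
      ‖bergmanKernel Ω 1 ζ z'‖ + ‖bergmanKernel Ω 1 ζ z‖)) (𝓝 z) (𝓝 (∫ _ζ in Ω, (0 : ℝ))) := by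
    refine tendsto_integral_filter_of_dominated_convergence
      (fun ζ => 2 * ‖bergmanKernel Ω 1 ζ z‖) ?_ ?_ ((hint z).norm.const_mul 2) ?_
    · exact Eventually.of_forall fun z' =>
        ((((hint z').sub (hint z)).norm.sub (hint z').norm).add
          (hint z).norm).aestronglyMeasurable
    · refine Eventually.of_forall fun z' => ae_of_all _ fun ζ => ?_
      rw [Real.norm_eq_abs, abs_le]
      have h1 := norm_sub_le (bergmanKernel Ω 1 ζ z') (bergmanKernel Ω 1 ζ z)
      have h2 := norm_sub_norm_le (bergmanKernel Ω 1 ζ z') (bergmanKernel Ω 1 ζ z)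
      have h3 := norm_nonneg (bergmanKernel Ω 1 ζ z)
      constructor <;> linarith
    · refine ae_of_all _ fun ζ => ?_
      have h := tendsto_bergmanKernel hΩ hconn hb z ζ
      have h' := (((h.sub_const (bergmanKernel Ω 1 ζ z)).norm.sub h.norm).add_const
        ‖bergmanKernel Ω 1 ζ z‖)
      simpa using h'
  rw [integral_zero] at hD
  refine hD.congr fun z' => ?_
  have hsub : Integrable (fun ζ => ‖bergmanKernel Ω 1 ζ z' - bergmanKernel Ω 1 ζ z‖)
      (volume.restrict Ω) := ((hint z').sub (hint z)).norm
  have hsub' : Integrable (fun ζ => ‖bergmanKernel Ω 1 ζ z' - bergmanKernel Ω 1 ζ z‖ -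
      ‖bergmanKernel Ω 1 ζ z'‖) (volume.restrict Ω) := hsub.sub (hint z').norm
  rw [integral_add hsub' (hint z).norm, integral_sub hsub (hint z').norm,
    integral_norm_bergmanKernel hΩ hb z.2, integral_norm_bergmanKernel hΩ hb z'.2]
  ring

end Continuity

/-! ### The derivative of the extremal function on the diagonal -/

section Derivative

variable {n : ℕ} {Ω : Set (Cn n)}

/-- The estimate at nearby points. With `f`, `g` the extremal functions at `z`, `z'`, the defect
`D` of the triangle inequality for `f + g` satisfies `K(z) D ≤ Re (f - g)(z)` and
`K(z') D ≤ -Re (f - g)(z')`; adding up, `D` is bounded by the increment of `f - g` between `z` and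
`z'`. The bound on `D` controls the derivative of `f / g`. -/
lemma exists_norm_fderiv_bergmanKernel_sub_le_of_lt (hΩ : IsOpen Ω) (hb : Bornology.IsBounded Ω)
    {S : Set (Cn n)} (hSΩ : S ⊆ Ω) (hS : IsCompact S) :
    ∃ C > 0, ∃ ρ > 0, ∀ z ∈ S, ∀ z' ∈ S, ‖z - z'‖ < ρ →
      ‖fderiv ℂ (fun ζ => bergmanKernel Ω 1 ζ z) z -
        fderiv ℂ (fun ζ => bergmanKernel Ω 1 ζ z') z'‖ ≤
      C * √‖z - z'‖ * (√(∫ ζ in Ω, ‖bergmanKernel Ω 1 ζ z - bergmanKernel Ω 1 ζ z'‖) +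
        √‖z - z'‖) := by
  rcases S.eq_empty_or_nonempty with rfl | ⟨z₀, hz₀⟩
  · exact ⟨1, one_pos, 1, one_pos, fun z hz => absurd hz (Set.notMem_empty z)⟩
  obtain ⟨r, hr, A, hA, hrA⟩ := exists_uniform_norm_le hΩ hSΩ hS
  set κ := (volume.real Ω)⁻¹ with hκ
  have hκpos : 0 < κ := inv_pos.2 (ENNReal.toReal_pos
    (hΩ.measure_pos volume ⟨z₀, hSΩ hz₀⟩).ne' hb.measure_lt_top.ne)
  set L := A / r with hL
  have hLpos : 0 < L := by positivity
  -- `ρ` is so small that the extremal function at `z'` is at least `κ / 2` on the `ρ`-ball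
  -- around `z`, while its value at `z'` is at least `κ`
  set ρ := min r (κ / (4 * L)) with hρ
  have hρpos : 0 < ρ := by positivity
  have hρr : ρ ≤ r := min_le_left _ _
  have hρL : L * (2 * ρ) ≤ κ / 2 := by
    have : ρ ≤ κ / (4 * L) := min_le_right _ _
    rw [le_div_iff₀ (by positivity)] at this
    linarith
  obtain ⟨C₀, hC₀, hquot⟩ := exists_norm_fderiv_div_le n hA (by positivity : 0 < κ / 2) hρpos
  refine ⟨4 * L ^ 2 / κ + 4 * A / r ^ 2 + A * C₀ * √(L / (2 * κ)), by positivity, ρ, hρpos, ?_⟩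
  intro z hz z' hz' hzz'
  set f : Cn n → ℂ := fun ζ => bergmanKernel Ω 1 ζ z with hf
  set g : Cn n → ℂ := fun ζ => bergmanKernel Ω 1 ζ z' with hg
  set K := bergmanKernelDiag Ω 1 z with hK
  set K' := bergmanKernelDiag Ω 1 z' with hK'
  set d := ‖z - z'‖ with hd
  set T := ∫ ζ in Ω, ‖f ζ - g ζ‖ with hT
  have hd0 : 0 ≤ d := norm_nonneg _
  have hfm : f ∈ bergmanSpace Ω 1 := bergmanKernel_mem hΩ hb (hSΩ hz)
  have hgm : g ∈ bergmanSpace Ω 1 := bergmanKernel_mem hΩ hb (hSΩ hz')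
  have hf1 : ∫ ζ in Ω, ‖f ζ‖ = 1 := integral_norm_bergmanKernel hΩ hb (hSΩ hz)
  have hg1 : ∫ ζ in Ω, ‖g ζ‖ = 1 := integral_norm_bergmanKernel hΩ hb (hSΩ hz')
  have hfz : f z = K := bergmanKernel_self hΩ hb (hSΩ hz)
  have hgz' : g z' = K' := bergmanKernel_self hΩ hb (hSΩ hz')
  have hκK : κ ≤ K := inv_volume_le_bergmanKernelDiag hΩ hb (hSΩ hz)
  have hκK' : κ ≤ K' := inv_volume_le_bergmanKernelDiag hΩ hb (hSΩ hz')
  have hfb : ∀ w ∈ Metric.ball z (2 * r), ‖f w‖ ≤ A := fun w hw => by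
    simpa [hf1] using (hrA z hz).2 f hfm w hw
  have hgb : ∀ w ∈ Metric.ball z' (2 * r), ‖g w‖ ≤ A := fun w hw => by
    simpa [hg1] using (hrA z' hz').2 g hgm w hw
  have hgbz : ∀ w ∈ Metric.ball z (2 * r), ‖g w‖ ≤ A := fun w hw => by
    simpa [hg1] using (hrA z hz).2 g hgm w hw
  have hzball : z ∈ Metric.ball z' r := by
    rw [Metric.mem_ball, dist_eq_norm]; exact hzz'.trans_le hρr
  have hz'ball : z' ∈ Metric.ball z (2 * r) := by
    rw [Metric.mem_ball, dist_eq_norm, norm_sub_rev]; linarith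
  have hglip : ∀ w ∈ Metric.ball z' (2 * r), ‖g w - g z'‖ ≤ L * ‖w - z'‖ := fun w hw => by
    have := norm_sub_le_of_norm_le (hgm.1.mono (hrA z' hz').1) hgb hw
    rwa [mul_div_mul_left _ _ two_ne_zero] at this
  have hgK' : ∀ w ∈ Metric.ball z ρ, κ / 2 ≤ ‖g w‖ := by
    intro w hw
    have hwz' : ‖w - z'‖ < 2 * ρ := by
      have h1 : ‖w - z‖ < ρ := by rwa [Metric.mem_ball, dist_eq_norm] at hw
      have h2 := norm_sub_le_norm_sub_add_norm_sub w z z'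
      linarith
    have h1 := hglip w (by rw [Metric.mem_ball, dist_eq_norm]; linarith)
    have h2 : L * ‖w - z'‖ ≤ L * (2 * ρ) := by gcongr
    have h3 : ‖g z'‖ - ‖g w‖ ≤ ‖g w - g z'‖ := by
      rw [norm_sub_rev]; exact norm_sub_norm_le _ _
    have h4 : K' ≤ ‖g z'‖ := by
      rw [hgz', Complex.norm_real]; exact le_abs_self _
    linarith
  have hρsub : Metric.ball z ρ ⊆ Metric.ball z (2 * r) := Metric.ball_subset_ball (by linarith)
  have hρΩ : Metric.ball z ρ ⊆ Ω := hρsub.trans (hrA z hz).1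
  have hzρ : z ∈ Metric.ball z ρ := Metric.mem_ball_self hρpos
  have hgz0 : g z ≠ 0 := norm_pos_iff.1 ((by positivity : 0 < κ / 2).trans_le (hgK' z hzρ))
  -- the defect of the triangle inequality
  have hdef : (∫ ζ in Ω, ‖f ζ‖) + (∫ ζ in Ω, ‖g ζ‖) - ∫ ζ in Ω, ‖f ζ + g ζ‖ ≤
      L / (2 * κ) * (T * d) := by
    set N := ∫ ζ in Ω, ‖f ζ + g ζ‖ with hN
    rw [hf1, hg1]
    have hsum := add_mem_bergmanSpace_one hΩ hfm hgm
    -- the whole defect is nonnegative, as it dominates the part carried by the empty set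
    have hN2 : N ≤ 2 := by
      have := setIntegral_defect_le hΩ hfm hgm (Set.empty_subset Ω)
      rw [Measure.restrict_empty, integral_zero_measure, hf1, hg1] at this
      linarith
    have h1 : K + (g z).re ≤ K * N := by
      have := (Complex.re_le_norm _).trans (norm_le_bergmanKernelDiag_mul hΩ hb (hSΩ hz) hsum)
      rwa [hfz, Complex.add_re, Complex.ofReal_re] at this
    have h2 : (f z').re + K' ≤ K' * N := by
      have := (Complex.re_le_norm _).trans (norm_le_bergmanKernelDiag_mul hΩ hb (hSΩ hz') hsum)
      rwa [hgz', Complex.add_re, Complex.ofReal_re] at this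
    have hu := sub_mem_bergmanSpace_one hΩ hfm hgm
    have h3 := norm_sub_le_of_norm_le (hu.1.mono (hrA z hz).1) ((hrA z hz).2 _ hu) hz'ball
    have h4 : (K - (g z).re) - ((f z').re - K') ≤ L * (T * d) := by
      have h5 := (Complex.re_le_norm _).trans (norm_sub_rev (f z' - g z') (f z - g z) ▸ h3)
      rw [hfz, hgz', norm_sub_rev z' z] at h5
      simp only [Complex.sub_re, Complex.ofReal_re] at h5
      refine h5.trans (le_of_eq ?_)
      rw [hL, hT, hd]
      field_simp
    have h6 : κ * (2 - N) ≤ K * (2 - N) := mul_le_mul_of_nonneg_right hκK (by linarith)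
    have h7 : κ * (2 - N) ≤ K' * (2 - N) := mul_le_mul_of_nonneg_right hκK' (by linarith)
    rw [div_mul_eq_mul_div, le_div_iff₀ (by positivity)]
    linarith
  have hq := hquot z f g (L / (2 * κ) * (T * d)) (hfm.1.mono hρΩ) (hgm.1.mono hρΩ)
    (fun w hw => ⟨hfb w (hρsub hw), hgK' w hw⟩)
    (fun y s hys => (setIntegral_defect_le hΩ hfm hgm (hys.trans hρΩ)).trans hdef)
  have hT0 : 0 ≤ T := integral_nonneg fun _ => norm_nonneg _
  rw [Real.sqrt_mul (by positivity), Real.sqrt_mul hT0] at hq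
  -- `f' - g' = (f / g - 1) g' + g (f / g)'` at `z`
  have hfd : DifferentiableAt ℂ f z := hfm.1.differentiableAt (hΩ.mem_nhds (hSΩ hz))
  have hgd : DifferentiableAt ℂ g z := hgm.1.differentiableAt (hΩ.mem_nhds (hSΩ hz))
  have hqd : DifferentiableAt ℂ (fun w => f w / g w) z := by
    simp only [div_eq_mul_inv]
    exact hfd.mul (hgd.inv hgz0)
  have hfq : f =ᶠ[𝓝 z] fun w => f w / g w * g w := by
    filter_upwards [Metric.ball_mem_nhds z hρpos] with w hw
    rw [div_mul_cancel₀]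
    exact norm_pos_iff.1 ((by positivity : 0 < κ / 2).trans_le (hgK' w hw))
  have hf' : fderiv ℂ f z - fderiv ℂ g z =
      (f z / g z - 1) • fderiv ℂ g z + g z • fderiv ℂ (fun w => f w / g w) z := by
    rw [hfq.fderiv_eq, fderiv_fun_mul hqd hgd]
    ext v
    simp only [sub_apply, add_apply, smul_apply, smul_eq_mul]
    ring
  have hg'z : ‖fderiv ℂ g z‖ ≤ L := by
    have := norm_fderiv_le_of_norm_le (by positivity : 0 < 2 * r) (hgm.1.mono (hrA z hz).1) hgbz
    rwa [mul_div_mul_left _ _ two_ne_zero] at this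
  have hq1 : ‖f z / g z - 1‖ ≤ 4 * L / κ * d := by
    have h1 : f z / g z - 1 = (f z - g z) / g z := by field_simp
    have h2 : ‖f z - g z‖ ≤ 2 * L * d := by
      have h3 : f z - g z = ((K - K' : ℝ) : ℂ) - (g z - g z') := by
        rw [hfz, hgz']; push_cast; ring
      have h4 := abs_bergmanKernelDiag_sub_le hΩ hb hSΩ hrA hz hz' (by linarith)
      have h5 := hglip z (Metric.ball_subset_ball (by linarith) hzball)
      rw [h3]
      refine (norm_sub_le _ _).trans ?_
      rw [Complex.norm_real, Real.norm_eq_abs]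
      linarith
    rw [h1, norm_div, div_le_iff₀ (by linarith [hgK' z hzρ])]
    refine h2.trans ?_
    calc 2 * L * d = 4 * L / κ * d * (κ / 2) := by field_simp; ring
      _ ≤ _ := by
        have := hgK' z hzρ
        gcongr
  have hg'' : ‖fderiv ℂ g z - fderiv ℂ g z'‖ ≤ 4 * A / r ^ 2 * d :=
    norm_fderiv_sub_fderiv_le hr (hgm.1.mono (hrA z' hz').1) hgb hzball
  have hgA : ‖g z‖ ≤ A := hgbz z (Metric.mem_ball_self (by positivity))
  have hdd : √d * √d = d := Real.mul_self_sqrt hd0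
  have hsplit : fderiv ℂ f z - fderiv ℂ g z' =
      (f z / g z - 1) • fderiv ℂ g z + g z • fderiv ℂ (fun w => f w / g w) z +
        (fderiv ℂ g z - fderiv ℂ g z') := by
    rw [← hf']; abel
  calc ‖fderiv ℂ f z - fderiv ℂ g z'‖
      ≤ 4 * L / κ * d * L + A * (C₀ * (√(L / (2 * κ)) * (√T * √d))) + 4 * A / r ^ 2 * d := by
        rw [hsplit]
        refine (norm_add_le _ _).trans (add_le_add ((norm_add_le _ _).trans (add_le_add ?_ ?_)) hg'')
        · rw [norm_smul]
          gcongr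
        · rw [norm_smul]
          gcongr
    _ = (4 * L ^ 2 / κ + 4 * A / r ^ 2) * (√d * √d) + A * C₀ * √(L / (2 * κ)) * (√d * √T) := by
        rw [hdd]; ring
    _ ≤ (4 * L ^ 2 / κ + 4 * A / r ^ 2 + A * C₀ * √(L / (2 * κ))) * √d * (√T + √d) := by
        have h1 : 0 ≤ (4 * L ^ 2 / κ + 4 * A / r ^ 2) * (√d * √T) := by positivity
        have h2 : 0 ≤ A * C₀ * √(L / (2 * κ)) * (√d * √d) := by positivity
        linarith

lemma exists_norm_fderiv_bergmanKernel_sub_le (hΩ : IsOpen Ω) (hb : Bornology.IsBounded Ω)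
    {S : Set (Cn n)} (hSΩ : S ⊆ Ω) (hS : IsCompact S) :
    ∃ C > 0, ∀ z ∈ S, ∀ z' ∈ S,
      ‖fderiv ℂ (fun ζ => bergmanKernel Ω 1 ζ z) z -
        fderiv ℂ (fun ζ => bergmanKernel Ω 1 ζ z') z'‖ ≤
      C * √‖z - z'‖ * (√(∫ ζ in Ω, ‖bergmanKernel Ω 1 ζ z - bergmanKernel Ω 1 ζ z'‖) +
        √‖z - z'‖) := by
  obtain ⟨C, hC, ρ, hρ, hlt⟩ := exists_norm_fderiv_bergmanKernel_sub_le_of_lt hΩ hb hSΩ hS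
  obtain ⟨r, hr, A, hA, hrA⟩ := exists_uniform_norm_le hΩ hSΩ hS
  have hder : ∀ z ∈ S, ‖fderiv ℂ (fun ζ => bergmanKernel Ω 1 ζ z) z‖ ≤ A / r := by
    intro z hz
    have hk := bergmanKernel_mem hΩ hb (hSΩ hz)
    have := norm_fderiv_le_of_norm_le (by positivity : 0 < 2 * r) (hk.1.mono (hrA z hz).1)
      ((hrA z hz).2 _ hk)
    rwa [integral_norm_bergmanKernel hΩ hb (hSΩ hz), mul_one,
      mul_div_mul_left _ _ two_ne_zero] at this
  refine ⟨C + 2 * (A / r) / ρ, by positivity, fun z hz z' hz' => ?_⟩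
  set d := ‖z - z'‖ with hd
  set T := ∫ ζ in Ω, ‖bergmanKernel Ω 1 ζ z - bergmanKernel Ω 1 ζ z'‖
  have hdd : √d * √d = d := Real.mul_self_sqrt (norm_nonneg _)
  rcases lt_or_ge d ρ with h | h
  · refine (hlt z hz z' hz' h).trans ?_
    have : 0 ≤ 2 * (A / r) / ρ := by positivity
    gcongr
    linarith
  · refine (norm_sub_le _ _).trans ((add_le_add (hder z hz) (hder z' hz')).trans ?_)
    calc A / r + A / r = 2 * (A / r) / ρ * ρ := by field_simp; ring
      _ ≤ 2 * (A / r) / ρ * (√d * √d) := by rw [hdd]; gcongr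
      _ = 2 * (A / r) / ρ * √d * √d := by ring
      _ ≤ (C + 2 * (A / r) / ρ) * √d * (√T + √d) := by
        gcongr
        · linarith
        · linarith [Real.sqrt_nonneg T]

lemma integral_norm_bergmanKernel_sub_le (hΩ : IsOpen Ω) (hb : Bornology.IsBounded Ω)
    {z z' w : Cn n} (hz : z ∈ Ω) (hz' : z' ∈ Ω) (hw : w ∈ Ω) :
    ∫ ζ in Ω, ‖bergmanKernel Ω 1 ζ z - bergmanKernel Ω 1 ζ z'‖ ≤
      (∫ ζ in Ω, ‖bergmanKernel Ω 1 ζ z - bergmanKernel Ω 1 ζ w‖) +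
        ∫ ζ in Ω, ‖bergmanKernel Ω 1 ζ z' - bergmanKernel Ω 1 ζ w‖ := by
  have hint : ∀ x ∈ Ω, ∀ y ∈ Ω, Integrable (fun ζ => ‖bergmanKernel Ω 1 ζ x - bergmanKernel Ω 1 ζ y‖)
      (volume.restrict Ω) := fun x hx y hy => ((mem_bergmanSpace_one_iff hΩ).1
    (sub_mem_bergmanSpace_one hΩ (bergmanKernel_mem hΩ hb hx)
      (bergmanKernel_mem hΩ hb hy))).2.2.norm
  rw [← integral_add (hint z hz w hw) (hint z' hz' w hw)]
  refine integral_mono (hint z hz z' hz') ((hint z hz w hw).add (hint z' hz' w hw)) fun ζ => ?_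
  have := norm_sub_le_norm_sub_add_norm_sub (bergmanKernel Ω 1 ζ z) (bergmanKernel Ω 1 ζ w)
    (bergmanKernel Ω 1 ζ z')
  rwa [norm_sub_rev (bergmanKernel Ω 1 ζ w)] at this

lemma integral_norm_bergmanKernel_sub_le_two (hΩ : IsOpen Ω) (hb : Bornology.IsBounded Ω)
    {z z' : Cn n} (hz : z ∈ Ω) (hz' : z' ∈ Ω) :
    ∫ ζ in Ω, ‖bergmanKernel Ω 1 ζ z - bergmanKernel Ω 1 ζ z'‖ ≤ 2 := by
  have hint : ∀ x ∈ Ω, Integrable (fun ζ => bergmanKernel Ω 1 ζ x) (volume.restrict Ω) :=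
    fun x hx => ((mem_bergmanSpace_one_iff hΩ).1 (bergmanKernel_mem hΩ hb hx)).2.2
  have h : ∫ ζ in Ω, ‖bergmanKernel Ω 1 ζ z - bergmanKernel Ω 1 ζ z'‖ ≤
      ∫ ζ in Ω, (‖bergmanKernel Ω 1 ζ z‖ + ‖bergmanKernel Ω 1 ζ z'‖) :=
    integral_mono ((hint z hz).sub (hint z' hz')).norm ((hint z hz).norm.add (hint z' hz').norm)
      fun ζ => norm_sub_le _ _
  rw [integral_add (hint z hz).norm (hint z' hz').norm, integral_norm_bergmanKernel hΩ hb hz,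
    integral_norm_bergmanKernel hΩ hb hz'] at h
  linarith

lemma exists_integral_norm_bergmanKernel_sub_lt (hΩ : IsOpen Ω) (hconn : IsConnected Ω)
    (hb : Bornology.IsBounded Ω) {S : Set (Cn n)} (hSΩ : S ⊆ Ω) (hS : IsCompact S) {ε : ℝ}
    (hε : 0 < ε) :
    ∃ δ > 0, ∀ z ∈ S, ∀ z' ∈ S, ‖z - z'‖ < δ →
      ∫ ζ in Ω, ‖bergmanKernel Ω 1 ζ z - bergmanKernel Ω 1 ζ z'‖ < ε := by
  have hloc : ∀ x : Ω, ∃ δ > 0, ∀ y : Ω, dist y x < δ →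
      ∫ ζ in Ω, ‖bergmanKernel Ω 1 ζ y - bergmanKernel Ω 1 ζ x‖ < ε / 2 := fun x =>
    Metric.eventually_nhds_iff.1 ((tendsto_integral_norm_bergmanKernel_sub hΩ hconn hb
      x).eventually_lt_const (by positivity))
  choose δ hδ hδlt using hloc
  obtain ⟨η, hη, hcover⟩ := lebesgue_number_lemma_of_metric hS
    (c := fun x : Ω => Metric.ball (x : Cn n) (δ x)) (fun _ => Metric.isOpen_ball)
    fun x hx => Set.mem_iUnion.2 ⟨⟨x, hSΩ hx⟩, Metric.mem_ball_self (hδ _)⟩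
  refine ⟨η, hη, fun z hz z' hz' hzz' => ?_⟩
  obtain ⟨x, hx⟩ := hcover z hz
  have h1 := hδlt x ⟨z, hSΩ hz⟩ (hx (Metric.mem_ball_self hη))
  have h2 := hδlt x ⟨z', hSΩ hz'⟩ (hx (by rwa [Metric.mem_ball', dist_eq_norm]))
  have := integral_norm_bergmanKernel_sub_le hΩ hb (hSΩ hz) (hSΩ hz') x.2
  simp only at h1 h2
  linarith

end Derivative

/-! ### Differentiability of the diagonal kernel -/

section Regularity

variable {n : ℕ} {Ω : Set (Cn n)}

lemma continuousOn_fderiv_bergmanKernel (hΩ : IsOpen Ω) (hb : Bornology.IsBounded Ω) :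
    ContinuousOn (fun z => fderiv ℂ (fun ζ => bergmanKernel Ω 1 ζ z) z) Ω := by
  intro z hz
  apply ContinuousAt.continuousWithinAt
  obtain ⟨ε, hε, hsub⟩ := Metric.nhds_basis_closedBall.mem_iff.1 (hΩ.mem_nhds hz)
  obtain ⟨C, hC, hCle⟩ := exists_norm_fderiv_bergmanKernel_sub_le hΩ hb hsub
    (isCompact_closedBall z ε)
  rw [ContinuousAt, tendsto_iff_norm_sub_tendsto_zero]
  have hlim : Tendsto (fun w : Cn n => C * √‖w - z‖ * (√2 + √‖w - z‖)) (𝓝 z) (𝓝 0) := by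
    have : Continuous fun w : Cn n => C * √‖w - z‖ * (√2 + √‖w - z‖) := by fun_prop
    simpa using this.tendsto z
  refine squeeze_zero' (Eventually.of_forall fun _ => norm_nonneg _) ?_ hlim
  filter_upwards [Metric.closedBall_mem_nhds z hε] with w hw
  refine (hCle w hw z (Metric.mem_closedBall_self hε.le)).trans ?_
  have := integral_norm_bergmanKernel_sub_le_two hΩ hb (hsub hw) hz
  gcongr

/-- The diagonal kernel is differentiable: `K(w) ≥ Re K(w, z)` for all `w`, with equality for
`w = z`. Exchanging the roles of the two points gives the opposite inequality, with the derivative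
of the extremal function at the other point. -/
lemma hasFDerivAt_bergmanKernelDiag_one (hΩ : IsOpen Ω) (hb : Bornology.IsBounded Ω)
    {z : Cn n} (hz : z ∈ Ω) :
    HasFDerivAt (bergmanKernelDiag Ω 1) (Complex.reCLM.comp
      ((fderiv ℂ (fun ζ => bergmanKernel Ω 1 ζ z) z).restrictScalars ℝ)) z := by
  obtain ⟨ε, hε, hsub⟩ := Metric.nhds_basis_closedBall.mem_iff.1 (hΩ.mem_nhds hz)
  obtain ⟨r, hr, A, hA, hrA⟩ := exists_uniform_norm_le hΩ hsub (isCompact_closedBall z ε)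
  set F : Cn n → Cn n →L[ℂ] ℂ := fun z => fderiv ℂ (fun ζ => bergmanKernel Ω 1 ζ z) z with hF
  have htaylor : ∀ x ∈ Metric.closedBall z ε, ∀ y ∈ Metric.ball x r,
      ‖bergmanKernel Ω 1 y x - bergmanKernel Ω 1 x x - F x (y - x)‖ ≤
        4 * A / r ^ 2 * ‖y - x‖ ^ 2 := by
    intro x hx y hy
    have hk := bergmanKernel_mem hΩ hb (hsub hx)
    exact norm_sub_sub_fderiv_le hr (hk.1.mono (hrA x hx).1) (fun w hw => by
      have := (hrA x hx).2 _ hk w hw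
      rwa [integral_norm_bergmanKernel hΩ hb (hsub hx), mul_one] at this) hy
  have hzmem := Metric.mem_closedBall_self (x := z) hε.le
  have hF0 : Tendsto (fun w => 4 * A / r ^ 2 * ‖w - z‖ + ‖F w - F z‖) (𝓝 z) (𝓝 0) := by
    have h1 : Continuous fun w : Cn n => 4 * A / r ^ 2 * ‖w - z‖ := by fun_prop
    have h2 := tendsto_iff_norm_sub_tendsto_zero.1
      ((continuousOn_fderiv_bergmanKernel hΩ hb).continuousAt (hΩ.mem_nhds hz))
    simpa using (h1.tendsto z).add h2
  refine HasFDerivAt.of_isLittleO (Asymptotics.isLittleO_iff.2 fun c hc => ?_)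
  filter_upwards [Metric.closedBall_mem_nhds z hε, Metric.ball_mem_nhds z hr,
    hF0.eventually_le_const hc] with w hw hwr hwc
  have hlow := htaylor z hzmem w hwr
  have hup := htaylor w hw z (by rwa [Metric.mem_ball'] at hwr)
  have hlow' := bergmanKernelDiag_sub_le hΩ hb (hsub hw) hz
  have hup' := bergmanKernelDiag_sub_le hΩ hb hz (hsub hw)
  have hFd : ‖(F w - F z) (w - z)‖ ≤ ‖F w - F z‖ * ‖w - z‖ := (F w - F z).le_opNorm _
  have hneg : F w (z - w) = -(F w (w - z)) := by rw [← map_neg, neg_sub]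
  have h1 := abs_le.1 ((Complex.abs_re_le_norm _).trans hlow)
  have h2 := abs_le.1 ((Complex.abs_re_le_norm _).trans hup)
  have h3 := abs_le.1 ((Complex.abs_re_le_norm _).trans hFd)
  rw [norm_sub_rev z w, hneg] at h2
  simp only [Complex.sub_re, Complex.neg_re, sub_apply] at h1 h2 h3 hlow' hup'
  have hgoal : (Complex.reCLM.comp ((F z).restrictScalars ℝ)) (w - z) = (F z (w - z)).re := rfl
  rw [hgoal, Real.norm_eq_abs]
  refine le_trans ?_ (mul_le_mul_of_nonneg_right hwc (norm_nonneg _))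
  have hnn : 0 ≤ ‖F w - F z‖ * ‖w - z‖ := by positivity
  rw [add_mul, mul_assoc, ← pow_two, abs_le]
  constructor <;> linarith

lemma norm_realBasisVec (j : Fin n ⊕ Fin n) : ‖realBasisVec j‖ = 1 := by
  rcases j with k | k <;> simp [realBasisVec]

lemma realPartial_bergmanKernelDiag_one (hΩ : IsOpen Ω) (hb : Bornology.IsBounded Ω) {z : Cn n}
    (hz : z ∈ Ω) (j : Fin n ⊕ Fin n) :
    realPartial j (bergmanKernelDiag Ω 1) z =
      (fderiv ℂ (fun ζ => bergmanKernel Ω 1 ζ z) z (realBasisVec j)).re :=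
  ((hasFDerivAt_bergmanKernelDiag_one hΩ hb hz).hasLineDerivAt _).lineDeriv

lemma realPartial_bergmanKernel (hΩ : IsOpen Ω) (hb : Bornology.IsBounded Ω) {z : Cn n}
    (hz : z ∈ Ω) (j : Fin n ⊕ Fin n) :
    realPartial j (fun ζ => bergmanKernel Ω 1 ζ z) z =
      fderiv ℂ (fun ζ => bergmanKernel Ω 1 ζ z) z (realBasisVec j) := by
  have hd := (bergmanKernel_mem hΩ hb hz).1.differentiableAt (hΩ.mem_nhds hz)
  exact ((hd.hasFDerivAt.restrictScalars ℝ).hasLineDerivAt _).lineDeriv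

lemma abs_realPartial_sub_le (hΩ : IsOpen Ω) (hb : Bornology.IsBounded Ω) {z z' : Cn n}
    (hz : z ∈ Ω) (hz' : z' ∈ Ω) (j : Fin n ⊕ Fin n) :
    |realPartial j (bergmanKernelDiag Ω 1) z - realPartial j (bergmanKernelDiag Ω 1) z'| ≤
      ‖fderiv ℂ (fun ζ => bergmanKernel Ω 1 ζ z) z -
        fderiv ℂ (fun ζ => bergmanKernel Ω 1 ζ z') z'‖ := by
  rw [realPartial_bergmanKernelDiag_one hΩ hb hz, realPartial_bergmanKernelDiag_one hΩ hb hz',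
    ← Complex.sub_re, ← sub_apply]
  refine (Complex.abs_re_le_norm _).trans ((ContinuousLinearMap.le_opNorm _ _).trans ?_)
  rw [norm_realBasisVec, mul_one]

lemma contDiffOn_bergmanKernelDiag_one (hΩ : IsOpen Ω) (hb : Bornology.IsBounded Ω) :
    ContDiffOn ℝ 1 (bergmanKernelDiag Ω 1) Ω := by
  rw [← zero_add (1 : WithTop ℕ∞), contDiffOn_succ_iff_fderiv_of_isOpen hΩ]
  refine ⟨fun z hz => (hasFDerivAt_bergmanKernelDiag_one hΩ
    hb hz).differentiableAt.differentiableWithinAt, by simp, contDiffOn_zero.2 ?_⟩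
  refine ContinuousOn.congr (f := fun z => Complex.reCLM.comp
    ((fderiv ℂ (fun ζ => bergmanKernel Ω 1 ζ z) z).restrictScalars ℝ)) ?_
    fun z hz => (hasFDerivAt_bergmanKernelDiag_one hΩ hb hz).fderiv
  have h := (ContinuousLinearMap.continuous_restrictScalars (𝕜 := ℂ) (𝕜' := ℝ) (E := Cn n)
    (F := ℂ)).comp_continuousOn (continuousOn_fderiv_bergmanKernel hΩ hb)
  exact continuousOn_const.clm_comp h

end Regularity

/-! ### Regularity of `K_1` -/

theorem theorem1p4 {n : ℕ} (Ω : Set (Cn n)) (hΩ_open : IsOpen Ω) (hΩ_conn : IsConnected Ω)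
    (hΩ_bdd : Bornology.IsBounded Ω)
    (hlim : ∀ z ∈ Ω, Tendsto (fun p : ℝ => bergmanKernelDiag Ω p z) (𝓝[>] 1)
      (𝓝 (bergmanKernelDiag Ω 1 z))) :
    IsLocC1Holder Ω (1 / 2) (bergmanKernelDiag Ω 1) ∧
    (∀ z ∈ Ω, ∀ j : Fin n ⊕ Fin n,
      realPartial j (bergmanKernelDiag Ω 1) z =
        (realPartial j (fun ζ => bergmanKernel Ω 1 ζ z) z).re) ∧
    (∀ S : Set (Cn n), S ⊆ Ω → IsCompact S →
      ∃ C : ℝ, 0 < C ∧ ∀ z ∈ S, ∀ z' ∈ S, ∀ j : Fin n ⊕ Fin n,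
        |realPartial j (bergmanKernelDiag Ω 1) z - realPartial j (bergmanKernelDiag Ω 1) z'| ≤
          C * ‖z - z'‖ ^ (1 / 2 : ℝ) *
            (bergmanNorm Ω 1 (fun ζ => bergmanKernel Ω 1 ζ z - bergmanKernel Ω 1 ζ z')
                ^ (1 / 2 : ℝ) + ‖z - z'‖ ^ (1 / 2 : ℝ))) ∧
    (∀ S : Set (Cn n), S ⊆ Ω → IsCompact S →
      ∀ ε : ℝ, 0 < ε → ∃ δ : ℝ, 0 < δ ∧ ∀ z ∈ S, ∀ z' ∈ S, ‖z - z'‖ < δ →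
        ∀ j : Fin n ⊕ Fin n,
          |realPartial j (bergmanKernelDiag Ω 1) z - realPartial j (bergmanKernelDiag Ω 1) z'| ≤
            ε * ‖z - z'‖ ^ (1 / 2 : ℝ)) := by
  have hsqrt : ∀ t : ℝ, t ^ (1 / 2 : ℝ) = √t := fun t => (Real.sqrt_eq_rpow t).symm
  refine ⟨⟨contDiffOn_bergmanKernelDiag_one hΩ_open hΩ_bdd, fun j S hSΩ hS => ?_⟩,
    fun z hz j => ?_, fun S hSΩ hS => ?_, fun S hSΩ hS ε hε => ?_⟩
  · obtain ⟨C, hC, hle⟩ := exists_norm_fderiv_bergmanKernel_sub_le hΩ_open hΩ_bdd hSΩ hS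
    obtain ⟨R, hR⟩ := Metric.isBounded_iff.1 hS.isBounded
    refine ⟨(C * (√2 + √R)).toNNReal, fun z hz z' hz' => ?_⟩
    have hT := integral_norm_bergmanKernel_sub_le_two hΩ_open hΩ_bdd (hSΩ hz) (hSΩ hz')
    have hd : ‖z - z'‖ ≤ R := by
      rw [← dist_eq_norm]
      exact hR hz hz'
    have key : dist (realPartial j (bergmanKernelDiag Ω 1) z)
        (realPartial j (bergmanKernelDiag Ω 1) z') ≤
        C * (√2 + √R) * dist z z' ^ (1 / 2 : ℝ) := by
      rw [Real.dist_eq, hsqrt, dist_eq_norm]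
      refine (abs_realPartial_sub_le hΩ_open hΩ_bdd (hSΩ hz) (hSΩ hz') j).trans
        ((hle z hz z' hz').trans ?_)
      rw [mul_right_comm]
      gcongr
    have hexp : ((1 / 2 : ℝ≥0) : ℝ) = 1 / 2 := by norm_num
    rw [edist_dist, edist_dist, hexp, ENNReal.ofReal_rpow_of_nonneg dist_nonneg (by positivity)]
    change _ ≤ ENNReal.ofReal _ * _
    rw [← ENNReal.ofReal_mul (by positivity)]
    exact ENNReal.ofReal_le_ofReal key
  · rw [realPartial_bergmanKernelDiag_one hΩ_open hΩ_bdd hz,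
      realPartial_bergmanKernel hΩ_open hΩ_bdd hz]
  · obtain ⟨C, hC, hle⟩ := exists_norm_fderiv_bergmanKernel_sub_le hΩ_open hΩ_bdd hSΩ hS
    refine ⟨C, hC, fun z hz z' hz' j => ?_⟩
    rw [hsqrt, hsqrt, bergmanNorm_one]
    exact (abs_realPartial_sub_le hΩ_open hΩ_bdd (hSΩ hz) (hSΩ hz') j).trans (hle z hz z' hz')
  · obtain ⟨C, hC, hle⟩ := exists_norm_fderiv_bergmanKernel_sub_le hΩ_open hΩ_bdd hSΩ hS
    set η := ε / (2 * C) with hη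
    have hηpos : 0 < η := by positivity
    obtain ⟨δ, hδ, hlt⟩ := exists_integral_norm_bergmanKernel_sub_lt hΩ_open hΩ_conn hΩ_bdd hSΩ hS
      (by positivity : 0 < η ^ 2)
    refine ⟨min δ (η ^ 2), by positivity, fun z hz z' hz' hzz' j => ?_⟩
    rw [hsqrt]
    refine (abs_realPartial_sub_le hΩ_open hΩ_bdd (hSΩ hz) (hSΩ hz') j).trans
      ((hle z hz z' hz').trans ?_)
    have h1 : √(∫ ζ in Ω, ‖bergmanKernel Ω 1 ζ z - bergmanKernel Ω 1 ζ z'‖) ≤ η :=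
      Real.sqrt_le_iff.2 ⟨hηpos.le, (hlt z hz z' hz' (hzz'.trans_le (min_le_left _ _))).le⟩
    have h2 : √‖z - z'‖ ≤ η :=
      Real.sqrt_le_iff.2 ⟨hηpos.le, (hzz'.trans_le (min_le_right _ _)).le⟩
    calc C * √‖z - z'‖ * (√(∫ ζ in Ω, ‖bergmanKernel Ω 1 ζ z - bergmanKernel Ω 1 ζ z'‖) +
          √‖z - z'‖) ≤ C * √‖z - z'‖ * (η + η) := by gcongr
      _ = ε * √‖z - z'‖ := by rw [hη]; field_simp; ring
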